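/- Let $M$ be a smooth 4-manifold with boundary $\mathcal H=\partial M$, and let $\tilde g$ be a smooth Lorentzian metric of signature $(+,-,-,-)$ with $\mathrm{Ric}(\tilde g)=0$ on $\tilde M = M\setminus\mathcal H$. Suppose that $(\tilde M,\tilde g)$ is asymptotically Minkowskian at spatial infinity (AMSI) with asymptote $\mathcal H$, that is, there is a smooth function $\Omega$ on $M$, non-vanishing on $\tilde M$, such that (i) $\Omega=0$ and $d\Omega\neq 0$ on $\mathcal H$; (ii) the tensor field $q=\Omega^2(\tilde g+\Omega^{-4}\,d\Omega\otimes d\Omega)$ and the vector field $N=\Omega^{-4}\,\tilde g^\sharp(d\Omega,\cdot)$ on $\tilde M$ extend smoothly to $M$, and the pullback of $q$ to $\mathcal H$ has signature $(+,-,-)$; (iii) $\mathcal H$ is homeomorphic to $\mathbb R\times\mathbb S^2$; (iv) $\mathcal H$ is geodesically complete with respect to the pullback of $q$. Let $g=\Omega^2\tilde g$ on $\tilde M$. Then near each point of $\mathcal H$ one has $g^\sharp(d\Omega,d\Omega)<0$ on $\tilde M$, so that the hypersurfaces of constant $\Omega$ have the unit normal $n^a=g^{ab}\nabla_b\Omega/\sqrt{|g^{cd}\nabla_c\Omega\nabla_d\Omega|}$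 there, and the electric and magnetic parts of the Weyl tensor $C_{abcd}$ of $g$, $$E_{ab}=C_{acbd}\,n^c n^d,\qquad B_{ab}={}^*C_{acbd}\,n^c n^d,\qquad {}^*C_{acbd}=\tfrac12\,\epsilon_{ac}{}^{ef}C_{efbd},$$ where $\epsilon$ is the volume form of $g$ (the choice of orientation affects only the sign of $B_{ab}$), tend to zero on $\mathcal H$: for every point $p\in\mathcal H$ and every smooth chart of $M$ around $p$, all components $E_{ab}$ and $B_{ab}$ in that chart tend to $0$ as the point $x\in\tilde M$ tends to $p$. -/

import Mathlib

open scoped Manifold ContDiff Topology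

noncomputable section

namespace SpatialInfinity

/-! Local pseudo-Riemannian geometry: a metric is given by its component matrix `G`, a function of
the coordinates `y ∈ ℝⁿ`. -/

/-- The partial derivative `∂ₖ f` at the point `y` of `ℝⁿ`. -/
def partialD {n : ℕ} (k : Fin n) (f : EuclideanSpace ℝ (Fin n) → ℝ)
    (y : EuclideanSpace ℝ (Fin n)) : ℝ :=
  fderiv ℝ f y (EuclideanSpace.single k 1)

/-- `christoffel G y k i j` is the Christoffel symbol `Γᵏᵢⱼ` of `G` at `y`. -/
def christoffel {n : ℕ} (G : EuclideanSpace ℝ (Fin n) → Matrix (Fin n) (Fin n) ℝ)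
    (y : EuclideanSpace ℝ (Fin n)) (k i j : Fin n) : ℝ :=
  (1 / 2) * ∑ l, (G y)⁻¹ k l *
    (partialD i (fun z => G z l j) y + partialD j (fun z => G z l i) y
      - partialD l (fun z => G z i j) y)

/-- `riemann G y c d a b` is the component `Rᶜ_{dab}` of the curvature tensor, with the convention
`(∇ₐ∇_b - ∇_b∇ₐ) vᶜ = Rᶜ_{dab} vᵈ`. -/
def riemann {n : ℕ} (G : EuclideanSpace ℝ (Fin n) → Matrix (Fin n) (Fin n) ℝ)
    (y : EuclideanSpace ℝ (Fin n)) (c d a b : Fin n) : ℝ :=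
  partialD a (fun z => christoffel G z c b d) y - partialD b (fun z => christoffel G z c a d) y
    + ∑ e, (christoffel G y c a e * christoffel G y e b d
      - christoffel G y c b e * christoffel G y e a d)

/-- The Ricci tensor `R_{db} = Rᶜ_{dcb}`. -/
def ricci {n : ℕ} (G : EuclideanSpace ℝ (Fin n) → Matrix (Fin n) (Fin n) ℝ)
    (y : EuclideanSpace ℝ (Fin n)) (d b : Fin n) : ℝ :=
  ∑ c, riemann G y c d c b

/-- The Ricci scalar. -/
def ricciScalar {n : ℕ} (G : EuclideanSpace ℝ (Fin n) → Matrix (Fin n) (Fin n) ℝ)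
    (y : EuclideanSpace ℝ (Fin n)) : ℝ :=
  ∑ a, ∑ b, (G y)⁻¹ a b * ricci G y a b

/-- The Schouten tensor `L_{ab} = (R_{ab} - R g_{ab} / 6) / 2` of a four-dimensional metric. -/
def schouten (G : EuclideanSpace ℝ (Fin 4) → Matrix (Fin 4) (Fin 4) ℝ)
    (y : EuclideanSpace ℝ (Fin 4)) (a b : Fin 4) : ℝ :=
  (1 / 2) * (ricci G y a b - (1 / 6) * ricciScalar G y * G y a b)

/-- `weyl G y c d a b` is the component `C_{cdab}` of the Weyl tensor, all indices lowered with the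
metric: `R_{cdab} = C_{cdab} + g_{ca} L_{bd} - g_{cb} L_{ad} - g_{da} L_{bc} + g_{db} L_{ac}`. -/
def weyl (G : EuclideanSpace ℝ (Fin 4) → Matrix (Fin 4) (Fin 4) ℝ)
    (y : EuclideanSpace ℝ (Fin 4)) (c d a b : Fin 4) : ℝ :=
  (∑ e, G y c e * riemann G y e d a b)
    - (G y c a * schouten G y b d - G y c b * schouten G y a d
      - G y d a * schouten G y b c + G y d b * schouten G y a c)

/-- Components `ε_{abcd}` of the metric volume form of the matrix `A`, for the orientation given by
the coordinates: `√|det A|` times the permutation symbol. -/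
def volumeForm (A : Matrix (Fin 4) (Fin 4) ℝ) (a b c d : Fin 4) : ℝ :=
  Real.sqrt |A.det| * ((1 : Matrix (Fin 4) (Fin 4) ℝ).submatrix ![a, b, c, d] id).det

/-- The left Hodge dual `*C_{acbd} = (1/2) ε_{ac}{}^{ef} C_{efbd}` of the Weyl tensor. -/
def weylDual (G : EuclideanSpace ℝ (Fin 4) → Matrix (Fin 4) (Fin 4) ℝ)
    (y : EuclideanSpace ℝ (Fin 4)) (a c b d : Fin 4) : ℝ :=
  (1 / 2) * ∑ p, ∑ r, ∑ e, ∑ f,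
    volumeForm (G y) a c p r * (G y)⁻¹ p e * (G y)⁻¹ r f * weyl G y e f b d

/-- The squared norm `g^{ab} α_a α_b` of the covector `α`. -/
def covectorSq (A : Matrix (Fin 4) (Fin 4) ℝ) (α : Fin 4 → ℝ) : ℝ :=
  ∑ a, ∑ b, A⁻¹ a b * α a * α b

/-- The unit normal `nᵃ = g^{ab} α_b / √|g^{cd} α_c α_d|` with conormal `α`. -/
def unitNormal (A : Matrix (Fin 4) (Fin 4) ℝ) (α : Fin 4 → ℝ) (a : Fin 4) : ℝ :=
  (∑ b, A⁻¹ a b * α b) / Real.sqrt |covectorSq A α|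

/-- The electric part `E_{ab} = C_{acbd} nᶜ nᵈ` of the Weyl tensor of `G` with respect to the unit
normal to the level sets of `w`. -/
def electricPart (G : EuclideanSpace ℝ (Fin 4) → Matrix (Fin 4) (Fin 4) ℝ)
    (w : EuclideanSpace ℝ (Fin 4) → ℝ) (y : EuclideanSpace ℝ (Fin 4)) (a b : Fin 4) : ℝ :=
  ∑ c, ∑ d, weyl G y a c b d * unitNormal (G y) (fun k => partialD k w y) c
    * unitNormal (G y) (fun k => partialD k w y) d

/-- The magnetic part `B_{ab} = *C_{acbd} nᶜ nᵈ` of the Weyl tensor of `G` with respect to the unit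
normal to the level sets of `w`. -/
def magneticPart (G : EuclideanSpace ℝ (Fin 4) → Matrix (Fin 4) (Fin 4) ℝ)
    (w : EuclideanSpace ℝ (Fin 4) → ℝ) (y : EuclideanSpace ℝ (Fin 4)) (a b : Fin 4) : ℝ :=
  ∑ c, ∑ d, weylDual G y a c b d * unitNormal (G y) (fun k => partialD k w y) c
    * unitNormal (G y) (fun k => partialD k w y) d

/-- A matrix of a symmetric bilinear form of signature `(+,-,…,-)`. -/
def HasLorentzSignature {n : ℕ} (A : Matrix (Fin (n + 1)) (Fin (n + 1)) ℝ) : Prop :=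
  ∃ P : Matrix (Fin (n + 1)) (Fin (n + 1)) ℝ, IsUnit P.det ∧
    P.transpose * A * P = Matrix.diagonal (Fin.cons 1 (fun _ => -1))

/-! Four-manifolds with boundary and the coordinate components of tensor fields on them. -/

/-- The coordinate vector `∂ᵢ` of the chart `e`, at the point with coordinates `y`. -/
def coordVec {M : Type*} [TopologicalSpace M] [ChartedSpace (EuclideanHalfSpace 4) M]
    (e : OpenPartialHomeomorph M (EuclideanHalfSpace 4)) (y : EuclideanSpace ℝ (Fin 4))
    (i : Fin 4) : TangentSpace (𝓡∂ 4) ((e.extend (𝓡∂ 4)).symm y) :=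
  mfderivWithin 𝓘(ℝ, EuclideanSpace ℝ (Fin 4)) (𝓡∂ 4) (e.extend (𝓡∂ 4)).symm
    (Set.range (𝓡∂ 4)) y (EuclideanSpace.single i (1 : ℝ) : EuclideanSpace ℝ (Fin 4))

/-- The components of a covariant 2-tensor field in the chart `e`. -/
def components {M : Type*} [TopologicalSpace M] [ChartedSpace (EuclideanHalfSpace 4) M]
    (e : OpenPartialHomeomorph M (EuclideanHalfSpace 4))
    (g : ∀ x : M, LinearMap.BilinForm ℝ (TangentSpace (𝓡∂ 4) x))
    (y : EuclideanSpace ℝ (Fin 4)) : Matrix (Fin 4) (Fin 4) ℝ :=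
  Matrix.of fun i j => g ((e.extend (𝓡∂ 4)).symm y) (coordVec e y i) (coordVec e y j)

/-- The coordinate expression of a vector field in the chart `e`. -/
def vectorComponents {M : Type*} [TopologicalSpace M] [ChartedSpace (EuclideanHalfSpace 4) M]
    (e : OpenPartialHomeomorph M (EuclideanHalfSpace 4))
    (N : ∀ x : M, TangentSpace (𝓡∂ 4) x)
    (y : EuclideanSpace ℝ (Fin 4)) : EuclideanSpace ℝ (Fin 4) :=
  mfderiv (𝓡∂ 4) 𝓘(ℝ, EuclideanSpace ℝ (Fin 4)) (e.extend (𝓡∂ 4))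
    ((e.extend (𝓡∂ 4)).symm y) (N ((e.extend (𝓡∂ 4)).symm y))

/-- The conformal metric `Ω² g`. -/
def conformalMetric {M : Type*} [TopologicalSpace M] [ChartedSpace (EuclideanHalfSpace 4) M]
    (Ω : M → ℝ) (g : ∀ x : M, LinearMap.BilinForm ℝ (TangentSpace (𝓡∂ 4) x)) :
    ∀ x : M, LinearMap.BilinForm ℝ (TangentSpace (𝓡∂ 4) x) :=
  fun x => Ω x ^ 2 • g x

/-- The differential `dΩ` at `x`. -/
def differential {M : Type*} [TopologicalSpace M] [ChartedSpace (EuclideanHalfSpace 4) M]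
    (Ω : M → ℝ) (x : M) (v : TangentSpace (𝓡∂ 4) x) : ℝ :=
  (mfderiv (𝓡∂ 4) 𝓘(ℝ, ℝ) Ω x : TangentSpace (𝓡∂ 4) x →L[ℝ] ℝ) v

/-- `g` restricts to a smooth metric of signature `(+,-,-,-)` with vanishing Ricci tensor on the
interior of `M`; its values on the boundary are irrelevant. -/
structure IsVacuumSpacetime (M : Type*) [TopologicalSpace M]
    [ChartedSpace (EuclideanHalfSpace 4) M]
    (g : ∀ x : M, LinearMap.BilinForm ℝ (TangentSpace (𝓡∂ 4) x)) : Prop where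
  smooth : ∀ e ∈ IsManifold.maximalAtlas (𝓡∂ 4) ∞ M, ∀ i j,
    ContDiffOn ℝ ∞ (fun y => components e g y i j)
      ((e.extend (𝓡∂ 4)).target ∩ (e.extend (𝓡∂ 4)).symm ⁻¹' (𝓡∂ 4).interior M)
  lorentzian : ∀ e ∈ IsManifold.maximalAtlas (𝓡∂ 4) ∞ M,
    ∀ x ∈ e.source ∩ (𝓡∂ 4).interior M,
      HasLorentzSignature (components e g (e.extend (𝓡∂ 4) x))
  ricci_flat : ∀ e ∈ IsManifold.maximalAtlas (𝓡∂ 4) ∞ M,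
    ∀ x ∈ e.source ∩ (𝓡∂ 4).interior M, ∀ a b,
      ricci (components e g) (e.extend (𝓡∂ 4) x) a b = 0

/-! Geometry of the boundary. Each chart `e` of `M` restricts to a chart of the boundary, with
coordinates `(y₁, y₂, y₃)` on the slice `y₀ = 0`. -/

/-- The point `(0, z)` of the boundary slice of the half-space. -/
def slicePoint (z : EuclideanSpace ℝ (Fin 3)) : EuclideanSpace ℝ (Fin 4) :=
  WithLp.toLp 2 (Fin.cons 0 z : Fin 4 → ℝ)

/-- The boundary coordinates `(y₁, y₂, y₃)` of a point in the chart `e`. -/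
def bdryCoord {M : Type*} [TopologicalSpace M] [ChartedSpace (EuclideanHalfSpace 4) M]
    (e : OpenPartialHomeomorph M (EuclideanHalfSpace 4)) (x : M) : EuclideanSpace ℝ (Fin 3) :=
  WithLp.toLp 2 fun i : Fin 3 => e.extend (𝓡∂ 4) x i.succ

/-- The components of the pullback of `q` to the boundary, as functions of the boundary
coordinates. -/
def bdryMetric {M : Type*} [TopologicalSpace M] [ChartedSpace (EuclideanHalfSpace 4) M]
    (e : OpenPartialHomeomorph M (EuclideanHalfSpace 4))
    (q : ∀ x : M, LinearMap.BilinForm ℝ (TangentSpace (𝓡∂ 4) x))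
    (z : EuclideanSpace ℝ (Fin 3)) : Matrix (Fin 3) (Fin 3) ℝ :=
  (components e q (slicePoint z)).submatrix Fin.succ Fin.succ

/-- `γ : ℝ → M` is an affinely parametrised geodesic of the boundary with its metric induced by
`q`. -/
structure IsBoundaryGeodesic {M : Type*} [TopologicalSpace M]
    [ChartedSpace (EuclideanHalfSpace 4) M]
    (q : ∀ x : M, LinearMap.BilinForm ℝ (TangentSpace (𝓡∂ 4) x)) (γ : ℝ → M) : Prop where
  mem_boundary : ∀ t, γ t ∈ (𝓡∂ 4).boundary M
  continuous : Continuous γ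
  contDiffAt : ∀ e ∈ IsManifold.maximalAtlas (𝓡∂ 4) ∞ M, ∀ t, γ t ∈ e.source →
    ContDiffAt ℝ 2 (fun s => bdryCoord e (γ s)) t
  geodesic_eq : ∀ e ∈ IsManifold.maximalAtlas (𝓡∂ 4) ∞ M, ∀ t, γ t ∈ e.source → ∀ k,
    iteratedDeriv 2 (fun s => bdryCoord e (γ s) k) t
      + ∑ i, ∑ j, christoffel (bdryMetric e q) (bdryCoord e (γ t)) k i j
        * deriv (fun s => bdryCoord e (γ s) i) t * deriv (fun s => bdryCoord e (γ s) j) t = 0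

/-- The boundary is geodesically complete with respect to the metric induced by `q`: through every
boundary point, with every initial velocity tangent to the boundary, there is a geodesic defined
on all of `ℝ`. -/
def BoundaryGeodesicallyComplete {M : Type*} [TopologicalSpace M]
    [ChartedSpace (EuclideanHalfSpace 4) M]
    (q : ∀ x : M, LinearMap.BilinForm ℝ (TangentSpace (𝓡∂ 4) x)) : Prop :=
  ∀ p ∈ (𝓡∂ 4).boundary M, ∀ e ∈ IsManifold.maximalAtlas (𝓡∂ 4) ∞ M, p ∈ e.source →
    ∀ v : EuclideanSpace ℝ (Fin 3), ∃ γ : ℝ → M, IsBoundaryGeodesic q γ ∧ γ 0 = p ∧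
      deriv (fun s => bdryCoord e (γ s)) 0 = v

/-- The vacuum spacetime (interior of `M`, metric `g`) possesses the boundary `H = ∂M` as an
asymptote at spatial infinity, with function `Ω`; `q` and `N` are the smooth extensions to `M` of
`Ω² (g + Ω⁻⁴ dΩ ⊗ dΩ)` and `Ω⁻⁴ g♯(dΩ, ·)`. -/
structure HasAsymptote (M : Type*) [TopologicalSpace M] [ChartedSpace (EuclideanHalfSpace 4) M]
    (g : ∀ x : M, LinearMap.BilinForm ℝ (TangentSpace (𝓡∂ 4) x)) (Ω : M → ℝ)
    (q : ∀ x : M, LinearMap.BilinForm ℝ (TangentSpace (𝓡∂ 4) x))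
    (N : ∀ x : M, TangentSpace (𝓡∂ 4) x) : Prop where
  vacuum : IsVacuumSpacetime M g
  smooth_factor : ContMDiff (𝓡∂ 4) 𝓘(ℝ, ℝ) ∞ Ω
  factor_ne_zero : ∀ x ∈ (𝓡∂ 4).interior M, Ω x ≠ 0
  factor_eq_zero : ∀ x ∈ (𝓡∂ 4).boundary M, Ω x = 0
  differential_ne_zero : ∀ x ∈ (𝓡∂ 4).boundary M,
    ∃ v : TangentSpace (𝓡∂ 4) x, differential Ω x v ≠ 0
  q_eq : ∀ x ∈ (𝓡∂ 4).interior M, ∀ v w : TangentSpace (𝓡∂ 4) x,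
    q x v w = Ω x ^ 2 * (g x v w + (Ω x ^ 4)⁻¹ * (differential Ω x v * differential Ω x w))
  q_smooth : ∀ e ∈ IsManifold.maximalAtlas (𝓡∂ 4) ∞ M, ∀ i j,
    ContDiffOn ℝ ∞ (fun y => components e q y i j) (e.extend (𝓡∂ 4)).target
  q_signature : ∀ e ∈ IsManifold.maximalAtlas (𝓡∂ 4) ∞ M,
    ∀ x ∈ e.source ∩ (𝓡∂ 4).boundary M, HasLorentzSignature (bdryMetric e q (bdryCoord e x))
  N_eq : ∀ x ∈ (𝓡∂ 4).interior M, ∀ v : TangentSpace (𝓡∂ 4) x,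
    g x (N x) v = (Ω x ^ 4)⁻¹ * differential Ω x v
  N_smooth : ∀ e ∈ IsManifold.maximalAtlas (𝓡∂ 4) ∞ M,
    ContDiffOn ℝ ∞ (vectorComponents e N) (e.extend (𝓡∂ 4)).target

/-- The spacetime (interior of `M`, metric `g`) is asymptotically Minkowskian at spatial infinity,
with asymptote `H = ∂M`: it has an asymptote, `H` is homeomorphic to `ℝ × S²`, and `H` is
geodesically complete with respect to the pullback of `q`. -/
structure IsAMSI (M : Type*) [TopologicalSpace M] [ChartedSpace (EuclideanHalfSpace 4) M]
    (g : ∀ x : M, LinearMap.BilinForm ℝ (TangentSpace (𝓡∂ 4) x)) (Ω : M → ℝ)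
    (q : ∀ x : M, LinearMap.BilinForm ℝ (TangentSpace (𝓡∂ 4) x))
    (N : ∀ x : M, TangentSpace (𝓡∂ 4) x) : Prop extends HasAsymptote M g Ω q N where
  topology : Nonempty
    ((𝓡∂ 4).boundary M ≃ₜ ℝ × Metric.sphere (0 : EuclideanSpace ℝ (Fin 3)) 1)
  complete : BoundaryGeodesicallyComplete q

end SpatialInfinity

end

/-!
Near a boundary point write `G = Ω² g̃` for the rescaled metric, `w` for `Ω` in a chart, and
`Q = G + w⁻² dw ⊗ dw`, which is smooth up to the boundary. Both the inverse of `G` and `w² det G`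
extend smoothly, although `G` itself does not.

* Since `g̃ = w⁻² G`, the Levi-Civita connection of `g̃` is the projective change by `-d log |w|`
  of the connection `K = Γ_G - V ⊗ G`, with `V` the vector dual to `-d log |w|`. The singular terms
  of `K` cancel, so it extends smoothly.
* The connection `K` satisfies a Hessian equation `∇dw = -w S` with `S` smooth. By the projective
  transformation law the curvature `R` of `g̃` is then smooth up to the boundary, and
  differentiating the Hessian equation gives `∂_c w Rᶜ_{dab} = w Y_{dab}` with `Y = d^∇ S` smooth.
* As `g̃` is Ricci flat and the Weyl tensor is conformally invariant, `C_{cdab} = G_{ce} Rᵉ_{dab}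
  = Q_{ce} Rᵉ_{dab} - w⁻¹ ∂_c w Y_{dab}`, so that `w C` extends smoothly.
* The unit normal is `w N` up to sign and a factor tending to `1`, so `nᶜ nᵈ` carries a factor `w²`.
  Hence `E = O(w)`. In `B` the indices contracted with the volume form are raised, which turns `C`
  into `R`, and `√|det G| = O(w⁻¹)`, so `B = O(w)` as well.
-/

noncomputable section

namespace SpatialInfinity

open Filter Set

section PartialD

variable {n : ℕ} {f g : EuclideanSpace ℝ (Fin n) → ℝ} {y : EuclideanSpace ℝ (Fin n)} {k : Fin n}

theorem partialD_congr (h : f =ᶠ[𝓝 y] g) : partialD k f y = partialD k g y := by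
  rw [partialD, partialD, h.fderiv_eq]

theorem partialD_const (c : ℝ) : partialD k (fun _ => c) y = 0 := by
  simp [partialD]

theorem partialD_add (hf : DifferentiableAt ℝ f y) (hg : DifferentiableAt ℝ g y) :
    partialD k (fun z => f z + g z) y = partialD k f y + partialD k g y := by
  simp [partialD, fderiv_fun_add hf hg]

theorem partialD_neg : partialD k (fun z => -f z) y = -partialD k f y := by
  simp [partialD, fderiv_fun_neg]

theorem partialD_sub (hf : DifferentiableAt ℝ f y) (hg : DifferentiableAt ℝ g y) :
    partialD k (fun z => f z - g z) y = partialD k f y - partialD k g y := by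
  simp [partialD, fderiv_fun_sub hf hg]

theorem partialD_mul (hf : DifferentiableAt ℝ f y) (hg : DifferentiableAt ℝ g y) :
    partialD k (fun z => f z * g z) y = partialD k f y * g y + f y * partialD k g y := by
  simp only [partialD, fderiv_fun_mul hf hg, add_apply, smul_apply, smul_eq_mul]
  ring

theorem partialD_const_mul (c : ℝ) (hf : DifferentiableAt ℝ f y) :
    partialD k (fun z => c * f z) y = c * partialD k f y := by
  rw [partialD_mul (differentiableAt_const c) hf, partialD_const, zero_mul, zero_add]

theorem partialD_sum {ι : Type*} {s : Finset ι} {F : ι → EuclideanSpace ℝ (Fin n) → ℝ}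
    (hF : ∀ i ∈ s, DifferentiableAt ℝ (F i) y) :
    partialD k (fun z => ∑ i ∈ s, F i z) y = ∑ i ∈ s, partialD k (F i) y := by
  simp [partialD, fderiv_fun_sum hF]

theorem partialD_inv (hf : DifferentiableAt ℝ f y) (h0 : f y ≠ 0) :
    partialD k (fun z => (f z)⁻¹) y = -(f y)⁻¹ ^ 2 * partialD k f y := by
  have h : HasFDerivAt (fun z => (f z)⁻¹) _ y :=
    (hasDerivAt_inv h0).comp_hasFDerivAt y hf.hasFDerivAt
  simp [partialD, h.fderiv]

theorem contDiffAt_partialD {m m' : WithTop ℕ∞} (hf : ContDiffAt ℝ m' f y) (hm : m + 1 ≤ m') :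
    ContDiffAt ℝ m (partialD k f) y :=
  (hf.fderiv_right hm).clm_apply contDiffAt_const

theorem differentiableAt_partialD (hf : ContDiffAt ℝ 2 f y) :
    DifferentiableAt ℝ (partialD k f) y :=
  (contDiffAt_partialD (m := 1) hf (by norm_num)).differentiableAt (by norm_num)

theorem partialD_comm (hf : ContDiffAt ℝ 2 f y) (i j : Fin n) :
    partialD i (partialD j f) y = partialD j (partialD i f) y := by
  have hdf : DifferentiableAt ℝ (fderiv ℝ f) y :=
    (hf.fderiv_right (m := 1) (by norm_num)).differentiableAt (by norm_num)
  have hsnd : ∀ a b : Fin n, partialD a (partialD b f) y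
      = fderiv ℝ (fderiv ℝ f) y (EuclideanSpace.single a 1) (EuclideanSpace.single b 1) := by
    intro a b
    change fderiv ℝ (fun z => fderiv ℝ f z (EuclideanSpace.single b 1)) y _ = _
    rw [fderiv_clm_apply hdf (differentiableAt_const _)]
    simp
  rw [hsnd, hsnd, hf.isSymmSndFDerivAt (by simp)]

end PartialD

section MatrixInverse

variable {E : Type*} [NormedAddCommGroup E] [NormedSpace ℝ E] {ι : Type*} [Fintype ι]
  [DecidableEq ι] {m : WithTop ℕ∞} {A : E → Matrix ι ι ℝ} {y : E}

theorem contDiffAt_matrix_det (hA : ∀ i j, ContDiffAt ℝ m (fun z => A z i j) y) :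
    ContDiffAt ℝ m (fun z => (A z).det) y := by
  simp only [Matrix.det_apply']
  exact ContDiffAt.sum fun _ _ => contDiffAt_const.mul (contDiffAt_prod fun _ _ => hA _ _)

theorem contDiffAt_matrix_inv (hA : ∀ i j, ContDiffAt ℝ m (fun z => A z i j) y)
    (hdet : IsUnit (A y).det) (i j : ι) : ContDiffAt ℝ m (fun z => (A z)⁻¹ i j) y := by
  simp only [Matrix.inv_def, Ring.inverse_eq_inv', Matrix.smul_apply, smul_eq_mul,
    Matrix.adjugate_apply]
  refine ((contDiffAt_matrix_det hA).inv hdet.ne_zero).mul (contDiffAt_matrix_det fun a b => ?_)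
  obtain rfl | haj := eq_or_ne a j
  · simpa only [Matrix.updateRow_self] using contDiffAt_const
  · simpa only [Matrix.updateRow_ne haj] using hA a b

end MatrixInverse

section Connection

variable {n : ℕ} {Γ : EuclideanSpace ℝ (Fin n) → Fin n → Fin n → Fin n → ℝ}
  {ψ : EuclideanSpace ℝ (Fin n) → Fin n → ℝ} {y : EuclideanSpace ℝ (Fin n)}

/-- The curvature `Rᶜ_{dab}` of the connection with coefficients `Γ y c i j = Γᶜᵢⱼ`, in the index
convention of `riemann`. -/
def curvature (Γ : EuclideanSpace ℝ (Fin n) → Fin n → Fin n → Fin n → ℝ)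
    (y : EuclideanSpace ℝ (Fin n)) (c d a b : Fin n) : ℝ :=
  partialD a (fun z => Γ z c b d) y - partialD b (fun z => Γ z c a d) y
    + ∑ e, (Γ y c a e * Γ y e b d - Γ y c b e * Γ y e a d)

/-- The covariant derivative `∇ᵢψⱼ` of the covector field `ψ`. -/
def covectorD (Γ : EuclideanSpace ℝ (Fin n) → Fin n → Fin n → Fin n → ℝ)
    (ψ : EuclideanSpace ℝ (Fin n) → Fin n → ℝ) (y : EuclideanSpace ℝ (Fin n)) (i j : Fin n) : ℝ :=
  partialD i (fun z => ψ z j) y - ∑ e, Γ y e i j * ψ y e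

/-- The covariant derivative `∇ₐVᶜ` of the vector field `V`. -/
def vectorD (Γ : EuclideanSpace ℝ (Fin n) → Fin n → Fin n → Fin n → ℝ)
    (V : EuclideanSpace ℝ (Fin n) → Fin n → ℝ) (y : EuclideanSpace ℝ (Fin n)) (a c : Fin n) : ℝ :=
  partialD a (fun z => V z c) y + ∑ e, Γ y c a e * V y e

/-- The connection `Γᶜᵢⱼ + δᶜᵢψⱼ + δᶜⱼψᵢ`, which has the same unparametrised geodesics as `Γ`. -/
def projectiveChange (Γ : EuclideanSpace ℝ (Fin n) → Fin n → Fin n → Fin n → ℝ)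
    (ψ : EuclideanSpace ℝ (Fin n) → Fin n → ℝ) (y : EuclideanSpace ℝ (Fin n))
    (c i j : Fin n) : ℝ :=
  Γ y c i j + ((1 : Matrix (Fin n) (Fin n) ℝ) c i * ψ y j
    + (1 : Matrix (Fin n) (Fin n) ℝ) c j * ψ y i)

/-- The tensor `P_{ij} = ∇ᵢψⱼ - ψᵢψⱼ` governing the curvature of `projectiveChange Γ ψ`. -/
def projectiveSchouten (Γ : EuclideanSpace ℝ (Fin n) → Fin n → Fin n → Fin n → ℝ)
    (ψ : EuclideanSpace ℝ (Fin n) → Fin n → ℝ) (y : EuclideanSpace ℝ (Fin n)) (i j : Fin n) : ℝ :=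
  covectorD Γ ψ y i j - ψ y i * ψ y j

theorem curvature_congr {Γ' : EuclideanSpace ℝ (Fin n) → Fin n → Fin n → Fin n → ℝ}
    (h : Γ =ᶠ[𝓝 y] Γ') : curvature Γ y = curvature Γ' y := by
  have hd : ∀ k c b d, partialD k (fun z => Γ z c b d) y = partialD k (fun z => Γ' z c b d) y :=
    fun k c b d => partialD_congr (h.mono fun z hz => by simp only [hz])
  ext c d a b
  simp only [curvature, hd, h.eq_of_nhds]

theorem covectorD_congr {φ : EuclideanSpace ℝ (Fin n) → Fin n → ℝ} (h : ψ =ᶠ[𝓝 y] φ) :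
    covectorD Γ ψ y = covectorD Γ φ y := by
  have hd : ∀ i j, partialD i (fun z => ψ z j) y = partialD i (fun z => φ z j) y :=
    fun i j => partialD_congr (h.mono fun z hz => by simp only [hz])
  ext i j
  simp only [covectorD, hd, h.eq_of_nhds]

theorem sum_one_mul (f : Fin n → ℝ) (c : Fin n) :
    ∑ e, (1 : Matrix (Fin n) (Fin n) ℝ) c e * f e = f c := by
  simp [Matrix.one_apply]

theorem sum_projectiveChange_mul (f : Fin n → ℝ) (c i : Fin n) :
    ∑ e, projectiveChange Γ ψ y c i e * f e = ∑ e, Γ y c i e * f e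
      + (1 : Matrix (Fin n) (Fin n) ℝ) c i * ∑ e, ψ y e * f e + ψ y i * f c := by
  rw [← sum_one_mul f c, Finset.mul_sum, Finset.mul_sum, ← Finset.sum_add_distrib,
    ← Finset.sum_add_distrib]
  exact Finset.sum_congr rfl fun e _ => by rw [projectiveChange]; ring

theorem sum_mul_projectiveChange (f : Fin n → ℝ) (i j : Fin n) :
    ∑ e, f e * projectiveChange Γ ψ y e i j
      = ∑ e, f e * Γ y e i j + f i * ψ y j + f j * ψ y i := by
  rw [← sum_one_mul f i, ← sum_one_mul f j, Finset.sum_mul, Finset.sum_mul,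
    ← Finset.sum_add_distrib, ← Finset.sum_add_distrib]
  refine Finset.sum_congr rfl fun e _ => ?_
  rw [projectiveChange, ← Matrix.transpose_apply 1 e i, ← Matrix.transpose_apply 1 e j,
    Matrix.transpose_one]
  ring

theorem partialD_projectiveChange (hΓ : ∀ c i j, DifferentiableAt ℝ (fun z => Γ z c i j) y)
    (hψ : ∀ i, DifferentiableAt ℝ (fun z => ψ z i) y) (k c i j : Fin n) :
    partialD k (fun z => projectiveChange Γ ψ z c i j) y = partialD k (fun z => Γ z c i j) y
      + ((1 : Matrix (Fin n) (Fin n) ℝ) c i * partialD k (fun z => ψ z j) y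
        + (1 : Matrix (Fin n) (Fin n) ℝ) c j * partialD k (fun z => ψ z i) y) := by
  simp only [projectiveChange]
  rw [partialD_add (by fun_prop) (by fun_prop), partialD_add (by fun_prop) (by fun_prop),
    partialD_const_mul _ (hψ j), partialD_const_mul _ (hψ i)]

theorem curvature_projectiveChange (hΓ : ∀ c i j, DifferentiableAt ℝ (fun z => Γ z c i j) y)
    (hψ : ∀ i, DifferentiableAt ℝ (fun z => ψ z i) y)
    (hsymm : ∀ c i j, Γ y c i j = Γ y c j i)
    (hclosed : ∀ i j, partialD i (fun z => ψ z j) y = partialD j (fun z => ψ z i) y)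
    (c d a b : Fin n) :
    curvature (projectiveChange Γ ψ) y c d a b = curvature Γ y c d a b
      + (1 : Matrix (Fin n) (Fin n) ℝ) c b * projectiveSchouten Γ ψ y a d
      - (1 : Matrix (Fin n) (Fin n) ℝ) c a * projectiveSchouten Γ ψ y b d := by
  have hquad : ∀ i j, ∑ e, projectiveChange Γ ψ y c i e * projectiveChange Γ ψ y e j d
      = ∑ e, Γ y c i e * Γ y e j d + Γ y c i j * ψ y d + Γ y c i d * ψ y j
        + (1 : Matrix (Fin n) (Fin n) ℝ) c i
          * (∑ e, Γ y e j d * ψ y e + ψ y j * ψ y d + ψ y d * ψ y j)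
        + ψ y i * projectiveChange Γ ψ y c j d := by
    intro i j
    rw [sum_projectiveChange_mul, sum_mul_projectiveChange, sum_mul_projectiveChange]
    simp only [mul_comm (ψ y _) (Γ y _ j d)]
  simp only [curvature, Finset.sum_sub_distrib, hquad, partialD_projectiveChange hΓ hψ]
  simp only [projectiveSchouten, covectorD, projectiveChange, hclosed b a, hsymm c b a]
  ring

end Connection

section LeviCivita

variable {n : ℕ} {G : EuclideanSpace ℝ (Fin n) → Matrix (Fin n) (Fin n) ℝ}
  {y : EuclideanSpace ℝ (Fin n)}

/-- The Christoffel symbol `Γ_{lij}` of `G` with all indices lowered. -/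
def lowerChristoffel (G : EuclideanSpace ℝ (Fin n) → Matrix (Fin n) (Fin n) ℝ)
    (y : EuclideanSpace ℝ (Fin n)) (l i j : Fin n) : ℝ :=
  (1 / 2) * (partialD i (fun z => G z l j) y + partialD j (fun z => G z l i) y
    - partialD l (fun z => G z i j) y)

theorem christoffel_eq_sum (k i j : Fin n) :
    christoffel G y k i j = ∑ l, (G y)⁻¹ k l * lowerChristoffel G y l i j := by
  rw [christoffel, Finset.mul_sum]
  exact Finset.sum_congr rfl fun l _ => by rw [lowerChristoffel]; ring

theorem sum_mul_christoffel (hdet : IsUnit (G y).det) (l i j : Fin n) :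
    ∑ k, G y l k * christoffel G y k i j = lowerChristoffel G y l i j := by
  have h : (G y).mulVec ((G y)⁻¹.mulVec fun m => lowerChristoffel G y m i j) l
      = lowerChristoffel G y l i j := by
    rw [Matrix.mulVec_mulVec, Matrix.mul_nonsing_inv _ hdet, Matrix.one_mulVec]
  simpa only [Matrix.mulVec, dotProduct, ← christoffel_eq_sum] using h

theorem partialD_symm (hsymm : ∀ᶠ z in 𝓝 y, (G z).IsSymm) (k i j : Fin n) :
    partialD k (fun z => G z i j) y = partialD k (fun z => G z j i) y :=
  partialD_congr (hsymm.mono fun _ hz => hz.apply j i)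

theorem christoffel_symm (hsymm : ∀ᶠ z in 𝓝 y, (G z).IsSymm) (k i j : Fin n) :
    christoffel G y k i j = christoffel G y k j i := by
  simp only [christoffel_eq_sum, lowerChristoffel, partialD_symm hsymm _ i j,
    add_comm (partialD i _ y)]

theorem partialD_metric (hsymm : ∀ᶠ z in 𝓝 y, (G z).IsSymm) (hdet : IsUnit (G y).det)
    (a i j : Fin n) :
    partialD a (fun z => G z i j) y
      = ∑ e, G y i e * christoffel G y e a j + ∑ e, G y j e * christoffel G y e a i := by
  rw [sum_mul_christoffel hdet, sum_mul_christoffel hdet, lowerChristoffel, lowerChristoffel,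
    partialD_symm hsymm a j i, partialD_symm hsymm i j a, partialD_symm hsymm j i a]
  ring

theorem differentiableAt_christoffel (hG : ∀ i j, ContDiffAt ℝ 2 (fun z => G z i j) y)
    (hdet : IsUnit (G y).det) (k i j : Fin n) :
    DifferentiableAt ℝ (fun z => christoffel G z k i j) y := by
  have hinv : ∀ l, DifferentiableAt ℝ (fun z => (G z)⁻¹ k l) y :=
    fun l => (contDiffAt_matrix_inv hG hdet k l).differentiableAt (by norm_num)
  have hpartial : ∀ a b c, DifferentiableAt ℝ (partialD a fun z => G z b c) y :=
    fun a b c => differentiableAt_partialD (hG b c)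
  exact (DifferentiableAt.fun_sum fun l _ =>
    (hinv l).fun_mul (((hpartial _ _ _).fun_add (hpartial _ _ _)).fun_sub
      (hpartial _ _ _))).const_mul _

end LeviCivita

section ConformalChange

variable {n : ℕ} {G : EuclideanSpace ℝ (Fin n) → Matrix (Fin n) (Fin n) ℝ}
  {Γ : EuclideanSpace ℝ (Fin n) → Fin n → Fin n → Fin n → ℝ}
  {V : EuclideanSpace ℝ (Fin n) → Fin n → ℝ} {w : EuclideanSpace ℝ (Fin n) → ℝ}
  {y : EuclideanSpace ℝ (Fin n)}

/-- The connection `Γᵏᵢⱼ - Vᵏ Gᵢⱼ`. For `Γ` the Levi-Civita connection of `G` and `V` the vector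
dual to `d φ`, a projective change of it is the Levi-Civita connection of `e^{2φ} G`. -/
def metricChange (Γ : EuclideanSpace ℝ (Fin n) → Fin n → Fin n → Fin n → ℝ)
    (V : EuclideanSpace ℝ (Fin n) → Fin n → ℝ)
    (G : EuclideanSpace ℝ (Fin n) → Matrix (Fin n) (Fin n) ℝ) (y : EuclideanSpace ℝ (Fin n))
    (k i j : Fin n) : ℝ :=
  Γ y k i j - V y k * G y i j

theorem curvature_metricChange (hΓ : ∀ c i j, DifferentiableAt ℝ (fun z => Γ z c i j) y)
    (hV : ∀ c, DifferentiableAt ℝ (fun z => V z c) y)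
    (hG : ∀ i j, DifferentiableAt ℝ (fun z => G z i j) y)
    (hsymm : ∀ c i j, Γ y c i j = Γ y c j i)
    (hmetric : ∀ a i j, partialD a (fun z => G z i j) y
      = ∑ e, G y i e * Γ y e a j + ∑ e, G y j e * Γ y e a i) (c d a b : Fin n) :
    curvature (metricChange Γ V G) y c d a b = curvature Γ y c d a b
      - (vectorD Γ V y a c - V y c * (G y).mulVec (V y) a) * G y b d
      + (vectorD Γ V y b c - V y c * (G y).mulVec (V y) b) * G y a d := by
  have hderiv : ∀ k i j, partialD k (fun z => metricChange Γ V G z c i j) y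
      = partialD k (fun z => Γ z c i j) y
        - (partialD k (fun z => V z c) y * G y i j + V y c * partialD k (fun z => G z i j) y) := by
    intro k i j
    simp only [metricChange]
    rw [partialD_sub (by fun_prop) (by fun_prop), partialD_mul (hV c) (hG i j)]
  have hquad : ∀ i j, ∑ e, metricChange Γ V G y c i e * metricChange Γ V G y e j d
      = ∑ e, Γ y c i e * Γ y e j d - (∑ e, Γ y c i e * V y e) * G y j d
        - V y c * ∑ e, G y i e * Γ y e j d + V y c * (G y).mulVec (V y) i * G y j d := by
    intro i j
    simp only [metricChange, Matrix.mulVec, dotProduct, Finset.mul_sum, Finset.sum_mul,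
      ← Finset.sum_sub_distrib, ← Finset.sum_add_distrib]
    exact Finset.sum_congr rfl fun e _ => by ring
  simp only [curvature, vectorD, Finset.sum_sub_distrib, hderiv, hquad, hmetric, hsymm _ b a]
  ring

theorem mulVec_vectorD (hV : ∀ c, DifferentiableAt ℝ (fun z => V z c) y)
    (hG : ∀ i j, DifferentiableAt ℝ (fun z => G z i j) y) (hGy : (G y).IsSymm)
    (hmetric : ∀ a i j, partialD a (fun z => G z i j) y
      = ∑ e, G y i e * Γ y e a j + ∑ e, G y j e * Γ y e a i) (a c : Fin n) :
    (G y).mulVec (vectorD Γ V y a) c = covectorD Γ (fun z => (G z).mulVec (V z)) y a c := by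
  have hderiv : partialD a (fun z => (G z).mulVec (V z) c) y
      = ∑ f, partialD a (fun z => G z c f) y * V y f
        + ∑ f, G y c f * partialD a (fun z => V z f) y := by
    simp only [Matrix.mulVec, dotProduct]
    rw [partialD_sum fun f _ => (hG c f).fun_mul (hV f), ← Finset.sum_add_distrib]
    exact Finset.sum_congr rfl fun f _ => partialD_mul (hG c f) (hV f)
  have hswap : ∑ e, Γ y e a c * (G y).mulVec (V y) e
      = ∑ f, (∑ e, G y f e * Γ y e a c) * V y f := by
    simp only [Matrix.mulVec, dotProduct, Finset.mul_sum, Finset.sum_mul]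
    rw [Finset.sum_comm]
    exact Finset.sum_congr rfl fun f _ => Finset.sum_congr rfl fun e _ => by
      rw [hGy.apply]; ring
  have hlower : ∑ e, G y c e * ∑ f, Γ y e a f * V y f
      = ∑ f, (∑ e, G y c e * Γ y e a f) * V y f := by
    simp only [Finset.mul_sum, Finset.sum_mul, ← mul_assoc]
    exact Finset.sum_comm
  simp only [covectorD, hderiv, hswap, hmetric, add_mul, Finset.sum_add_distrib]
  simp only [Matrix.mulVec, dotProduct, vectorD, mul_add, Finset.sum_add_distrib, hlower]
  ring

/-- The covector field `-d log |w|`, the differential of the exponent `φ` in `w⁻² = e^{2φ}`. -/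
def conformalGradient (w : EuclideanSpace ℝ (Fin n) → ℝ) (y : EuclideanSpace ℝ (Fin n))
    (i : Fin n) : ℝ :=
  -((w y)⁻¹ * partialD i w y)

theorem differentiableAt_conformalGradient (hw : ContDiffAt ℝ 2 w y) (hw0 : w y ≠ 0) (i : Fin n) :
    DifferentiableAt ℝ (fun z => conformalGradient w z i) y :=
  (((hw.differentiableAt (by norm_num)).inv hw0).mul (differentiableAt_partialD hw)).neg

theorem partialD_conformalGradient (hw : ContDiffAt ℝ 2 w y) (hw0 : w y ≠ 0) (i j : Fin n) :
    partialD i (fun z => conformalGradient w z j) y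
      = (w y)⁻¹ ^ 2 * (partialD i w y * partialD j w y)
        - (w y)⁻¹ * partialD i (partialD j w) y := by
  have hdiff := hw.differentiableAt (by norm_num)
  simp only [conformalGradient]
  rw [partialD_neg, partialD_mul (hdiff.fun_inv hw0) (differentiableAt_partialD hw),
    partialD_inv hdiff hw0]
  ring

theorem partialD_conformalGradient_comm (hw : ContDiffAt ℝ 2 w y) (hw0 : w y ≠ 0) (i j : Fin n) :
    partialD i (fun z => conformalGradient w z j) y
      = partialD j (fun z => conformalGradient w z i) y := by
  rw [partialD_conformalGradient hw hw0, partialD_conformalGradient hw hw0, partialD_comm hw i j]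
  ring

theorem lowerChristoffel_conformal (hw : DifferentiableAt ℝ w y) (hw0 : w y ≠ 0)
    (hG : ∀ i j, DifferentiableAt ℝ (fun z => G z i j) y) (l i j : Fin n) :
    lowerChristoffel (fun z => (w z)⁻¹ ^ 2 • G z) y l i j = (w y)⁻¹ ^ 2
      * (lowerChristoffel G y l i j + conformalGradient w y i * G y l j
        + conformalGradient w y j * G y l i - conformalGradient w y l * G y i j) := by
  have hderiv : ∀ k a b, partialD k (fun z => ((w z)⁻¹ ^ 2 • G z) a b) y = (w y)⁻¹ ^ 2
      * (partialD k (fun z => G z a b) y + 2 * conformalGradient w y k * G y a b) := by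
    intro k a b
    have hinv := hw.fun_inv hw0
    simp only [Matrix.smul_apply, smul_eq_mul, pow_two]
    rw [partialD_mul (hinv.fun_mul hinv) (hG a b), partialD_mul hinv hinv, partialD_inv hw hw0,
      conformalGradient]
    ring
  simp only [lowerChristoffel, hderiv]
  ring

theorem inv_smul_metric (hw0 : w y ≠ 0) (hdet : IsUnit (G y).det) :
    ((w y)⁻¹ ^ 2 • G y)⁻¹ = w y ^ 2 • (G y)⁻¹ := by
  refine Matrix.inv_eq_left_inv ?_
  rw [Matrix.smul_mul, Matrix.mul_smul, Matrix.nonsing_inv_mul _ hdet, smul_smul, ← mul_pow,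
    mul_inv_cancel₀ hw0, one_pow, one_smul]

theorem christoffel_conformal (hw : DifferentiableAt ℝ w y) (hw0 : w y ≠ 0)
    (hG : ∀ i j, DifferentiableAt ℝ (fun z => G z i j) y) (hdet : IsUnit (G y).det) :
    christoffel (fun z => (w z)⁻¹ ^ 2 • G z) y
      = projectiveChange (metricChange (christoffel G)
          (fun z => (G z)⁻¹.mulVec (conformalGradient w z)) G) (conformalGradient w) y := by
  ext k i j
  have hone : ∀ m, (1 : Matrix (Fin n) (Fin n) ℝ) k m = ∑ l, (G y)⁻¹ k l * G y l m := fun m => by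
    rw [← Matrix.mul_apply, Matrix.nonsing_inv_mul _ hdet]
  simp only [projectiveChange, metricChange, hone, christoffel_eq_sum, inv_smul_metric hw0 hdet,
    lowerChristoffel_conformal hw hw0 hG, Matrix.mulVec, dotProduct, Finset.sum_mul,
    Matrix.smul_apply, smul_eq_mul, ← Finset.sum_sub_distrib, ← Finset.sum_add_distrib]
  refine Finset.sum_congr rfl fun l _ => ?_
  field_simp
  ring

end ConformalChange

section ConformalCurvature

variable {n : ℕ} {G : EuclideanSpace ℝ (Fin n) → Matrix (Fin n) (Fin n) ℝ}
  {Γ : EuclideanSpace ℝ (Fin n) → Fin n → Fin n → Fin n → ℝ}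
  {V ψ : EuclideanSpace ℝ (Fin n) → Fin n → ℝ} {w : EuclideanSpace ℝ (Fin n) → ℝ}
  {y : EuclideanSpace ℝ (Fin n)}

/-- The Kulkarni–Nomizu product of `A` and `B`, with the index order and sign of the Schouten terms
in `weyl`. -/
def kulkarniNomizu (A B : Matrix (Fin n) (Fin n) ℝ) (c d a b : Fin n) : ℝ :=
  A c a * B b d - A c b * B a d - A d a * B b c + A d b * B a c

/-- The tensor `∇ᵢψⱼ - ψᵢψⱼ + ½ ψ(V) Gᵢⱼ`. For `ψ = d φ` and `V` the vector dual to `ψ`, it is the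
difference of the Schouten tensors of `G` and `e^{2φ} G`. -/
def schoutenChange (G : Matrix (Fin n) (Fin n) ℝ)
    (Γ : EuclideanSpace ℝ (Fin n) → Fin n → Fin n → Fin n → ℝ) (V : Fin n → ℝ)
    (ψ : EuclideanSpace ℝ (Fin n) → Fin n → ℝ) (y : EuclideanSpace ℝ (Fin n)) :
    Matrix (Fin n) (Fin n) ℝ :=
  Matrix.of fun i j => covectorD Γ ψ y i j - ψ y i * ψ y j + (1 / 2) * (∑ e, V e * ψ y e) * G i j

theorem schoutenChange_isSymm {A : Matrix (Fin n) (Fin n) ℝ} (hA : A.IsSymm)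
    (hsymm : ∀ c i j, Γ y c i j = Γ y c j i)
    (hclosed : ∀ i j, partialD i (fun z => ψ z j) y = partialD j (fun z => ψ z i) y)
    (v : Fin n → ℝ) : (schoutenChange A Γ v ψ y).IsSymm := by
  ext i j
  simp only [schoutenChange, Matrix.transpose_apply, Matrix.of_apply, covectorD, hclosed i j,
    hsymm _ i j, hA.apply i j, mul_comm (ψ y i)]

theorem projectiveSchouten_metricChange (i j : Fin n) :
    projectiveSchouten (metricChange Γ V G) ψ y i j
      = covectorD Γ ψ y i j + (∑ e, V y e * ψ y e) * G y i j - ψ y i * ψ y j := by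
  have hsum : ∑ e, metricChange Γ V G y e i j * ψ y e
      = ∑ e, Γ y e i j * ψ y e - (∑ e, V y e * ψ y e) * G y i j := by
    rw [Finset.sum_mul, ← Finset.sum_sub_distrib]
    exact Finset.sum_congr rfl fun e _ => by rw [metricChange]; ring
  rw [projectiveSchouten, covectorD, covectorD, hsum]
  ring

theorem mul_curvature_projectiveChange_metricChange
    (hΓ : ∀ c i j, DifferentiableAt ℝ (fun z => Γ z c i j) y)
    (hV : ∀ c, DifferentiableAt ℝ (fun z => V z c) y)
    (hψ : ∀ i, DifferentiableAt ℝ (fun z => ψ z i) y)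
    (hG : ∀ i j, DifferentiableAt ℝ (fun z => G z i j) y) (hGsymm : (G y).IsSymm)
    (hsymm : ∀ c i j, Γ y c i j = Γ y c j i)
    (hmetric : ∀ a i j, partialD a (fun z => G z i j) y
      = ∑ e, G y i e * Γ y e a j + ∑ e, G y j e * Γ y e a i)
    (hclosed : ∀ i j, partialD i (fun z => ψ z j) y = partialD j (fun z => ψ z i) y)
    (hdual : (fun z => (G z).mulVec (V z)) =ᶠ[𝓝 y] ψ) (c d a b : Fin n) :
    ∑ e, G y c e * curvature (projectiveChange (metricChange Γ V G) ψ) y e d a b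
      = ∑ e, G y c e * curvature Γ y e d a b
        - kulkarniNomizu (G y) (schoutenChange (G y) Γ (V y) ψ y) c d a b := by
  have hcurv := curvature_projectiveChange (Γ := metricChange Γ V G)
    (fun k i j => (hΓ k i j).fun_sub ((hV k).fun_mul (hG i j))) hψ
    (fun k i j => by simp only [metricChange, hsymm k i j, hGsymm.apply i j]) hclosed
  have hsub := curvature_metricChange hΓ hV hG hsymm hmetric
  have hV_lower : ∑ e, G y c e * V y e = ψ y c := congrFun hdual.eq_of_nhds c
  have hD_lower : ∀ i, ∑ e, G y c e * vectorD Γ V y i e = covectorD Γ ψ y i c := fun i => by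
    rw [← covectorD_congr hdual]
    exact mulVec_vectorD hV hG hGsymm hmetric i c
  have hone_lower : ∀ i, ∑ e, G y c e * (1 : Matrix (Fin n) (Fin n) ℝ) e i = G y c i := fun i => by
    rw [← Matrix.mul_apply, mul_one]
  have hexpand : ∀ e, G y c e * curvature (projectiveChange (metricChange Γ V G) ψ) y e d a b
      = G y c e * curvature Γ y e d a b
        - (G y c e * vectorD Γ V y a e - G y c e * V y e * ψ y a) * G y b d
        + (G y c e * vectorD Γ V y b e - G y c e * V y e * ψ y b) * G y a d
        + G y c e * (1 : Matrix (Fin n) (Fin n) ℝ) e b *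
          projectiveSchouten (metricChange Γ V G) ψ y a d
        - G y c e * (1 : Matrix (Fin n) (Fin n) ℝ) e a *
          projectiveSchouten (metricChange Γ V G) ψ y b d := fun e => by
    rw [hcurv, hsub, congrFun hdual.eq_of_nhds a, congrFun hdual.eq_of_nhds b]
    ring
  simp only [hexpand, Finset.sum_sub_distrib, Finset.sum_add_distrib, ← Finset.sum_mul, hV_lower,
    hD_lower, hone_lower, projectiveSchouten_metricChange, kulkarniNomizu, schoutenChange,
    Matrix.of_apply, hGsymm.apply d, hGsymm.apply c b, hGsymm.apply c a]
  ring

theorem riemann_conformal (hG : ∀ i j, ContDiffAt ℝ 2 (fun z => G z i j) y)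
    (hw : ContDiffAt ℝ 2 w y) (hw0 : w y ≠ 0) (hdet : IsUnit (G y).det) :
    riemann (fun z => (w z)⁻¹ ^ 2 • G z) y = curvature (projectiveChange
      (metricChange (christoffel G) (fun z => (G z)⁻¹.mulVec (conformalGradient w z)) G)
      (conformalGradient w)) y := by
  have hG' : ∀ᶠ z in 𝓝 y, ∀ i j, ContDiffAt ℝ 2 (fun x => G x i j) z :=
    Filter.eventually_all.2 fun i => Filter.eventually_all.2 fun j => (hG i j).eventually (by simp)
  refine curvature_congr ?_
  filter_upwards [hG', hw.eventually (by simp), hw.continuousAt.eventually_ne hw0,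
    (contDiffAt_matrix_det hG).continuousAt.eventually_ne hdet.ne_zero] with z h1 h2 h3 h4
  exact christoffel_conformal (h2.differentiableAt (by norm_num)) h3
    (fun i j => (h1 i j).differentiableAt (by norm_num)) h4.isUnit

theorem mul_riemann_conformal (hG : ∀ i j, ContDiffAt ℝ 2 (fun z => G z i j) y)
    (hw : ContDiffAt ℝ 2 w y) (hw0 : w y ≠ 0) (hsymm : ∀ᶠ z in 𝓝 y, (G z).IsSymm)
    (hdet : IsUnit (G y).det) (c d a b : Fin n) :
    ∑ e, G y c e * riemann (fun z => (w z)⁻¹ ^ 2 • G z) y e d a b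
      = ∑ e, G y c e * riemann G y e d a b
        - kulkarniNomizu (G y) (schoutenChange (G y) (christoffel G)
          ((G y)⁻¹.mulVec (conformalGradient w y)) (conformalGradient w) y) c d a b := by
  have hψ := differentiableAt_conformalGradient hw hw0
  have hV : ∀ k, DifferentiableAt ℝ (fun z => (G z)⁻¹.mulVec (conformalGradient w z) k) y := by
    intro k
    simp only [Matrix.mulVec, dotProduct]
    exact DifferentiableAt.fun_sum fun l _ =>
      ((contDiffAt_matrix_inv hG hdet k l).differentiableAt (by norm_num)).fun_mul (hψ l)
  rw [riemann_conformal hG hw hw0 hdet, mul_curvature_projectiveChange_metricChange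
    (differentiableAt_christoffel hG hdet) hV hψ
    (fun i j => (hG i j).differentiableAt (by norm_num))
    hsymm.self_of_nhds (christoffel_symm hsymm) (partialD_metric hsymm hdet)
    (partialD_conformalGradient_comm hw hw0)]
  · rfl
  · filter_upwards [(contDiffAt_matrix_det hG).continuousAt.eventually_ne hdet.ne_zero] with z hz
    rw [Matrix.mulVec_mulVec, Matrix.mul_nonsing_inv _ hz.isUnit, Matrix.one_mulVec]

end ConformalCurvature

section Trace

variable {n : ℕ} {A B : Matrix (Fin n) (Fin n) ℝ}

theorem sum_inv_mul_sum_mul (hdet : IsUnit A.det) (v : Fin n → ℝ)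
    (c : Fin n) : ∑ e, A⁻¹ c e * ∑ f, A e f * v f = v c := by
  have h : A⁻¹.mulVec (A.mulVec v) c = v c := by
    rw [Matrix.mulVec_mulVec, Matrix.nonsing_inv_mul _ hdet, Matrix.one_mulVec]
  exact h

theorem sum_inv_mul_self (hdet : IsUnit A.det) (hA : A.IsSymm) :
    ∑ a, ∑ b, A⁻¹ a b * A a b = n := by
  have h : ∀ a, ∑ b, A⁻¹ a b * A a b = 1 := fun a => by
    simp only [← hA.apply a, ← Matrix.mul_apply]
    rw [Matrix.nonsing_inv_mul _ hdet, Matrix.one_apply_eq]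
  simp [h]

theorem sum_inv_mul_kulkarniNomizu (hdet : IsUnit A.det) (hB : B.IsSymm)
    (d b : Fin n) :
    ∑ c, ∑ e, A⁻¹ c e * kulkarniNomizu A B e d c b
      = (n - 2) * B d b + (∑ c, ∑ e, A⁻¹ c e * B c e) * A d b := by
  have hleft : ∀ c f, ∑ e, A⁻¹ c e * A e f = (1 : Matrix (Fin n) (Fin n) ℝ) c f := fun c f => by
    rw [← Matrix.mul_apply, Matrix.nonsing_inv_mul _ hdet]
  have hright : ∀ e, ∑ c, A d c * A⁻¹ c e = (1 : Matrix (Fin n) (Fin n) ℝ) d e := fun e => by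
    rw [← Matrix.mul_apply, Matrix.mul_nonsing_inv _ hdet]
  have hsnd : ∑ c, ∑ e, A⁻¹ c e * (A e b * B c d) = B b d := by
    simp only [← mul_assoc, ← Finset.sum_mul, hleft]
    simp [Matrix.one_apply]
  have hthd : ∑ c, ∑ e, A⁻¹ c e * (A d c * B b e) = B b d := by
    rw [Finset.sum_comm]
    simp only [mul_left_comm (A⁻¹ _ _), ← mul_assoc, ← Finset.sum_mul, hright]
    simp [Matrix.one_apply]
  simp only [kulkarniNomizu, mul_add, mul_sub, Finset.sum_add_distrib, Finset.sum_sub_distrib, hsnd,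
    hthd, ← hB.apply b d]
  simp only [← mul_assoc, ← Finset.sum_mul, hleft, Matrix.one_apply_eq, Finset.sum_const,
    Finset.card_univ, Fintype.card_fin, nsmul_eq_mul, mul_right_comm _ (A d b)]
  ring

end Trace

section WeylTensor

variable {n : ℕ} {G : EuclideanSpace ℝ (Fin n) → Matrix (Fin n) (Fin n) ℝ}
  {w : EuclideanSpace ℝ (Fin n) → ℝ} {y : EuclideanSpace ℝ (Fin n)}

theorem ricci_conformal (hG : ∀ i j, ContDiffAt ℝ 2 (fun z => G z i j) y)
    (hw : ContDiffAt ℝ 2 w y) (hw0 : w y ≠ 0) (hsymm : ∀ᶠ z in 𝓝 y, (G z).IsSymm)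
    (hdet : IsUnit (G y).det) {B : Matrix (Fin n) (Fin n) ℝ}
    (hB : schoutenChange (G y) (christoffel G) ((G y)⁻¹.mulVec (conformalGradient w y))
      (conformalGradient w) y = B) (d b : Fin n) :
    ricci (fun z => (w z)⁻¹ ^ 2 • G z) y d b
      = ricci G y d b - ((n - 2) * B d b + (∑ c, ∑ e, (G y)⁻¹ c e * B c e) * G y d b) := by
  have hraise : ∀ G' : EuclideanSpace ℝ (Fin n) → Matrix (Fin n) (Fin n) ℝ,
      ricci G' y d b = ∑ c, ∑ e, (G y)⁻¹ c e * ∑ f, G y e f * riemann G' y f d c b := fun G' =>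
    Finset.sum_congr rfl fun c _ => (sum_inv_mul_sum_mul hdet (riemann G' y · d c b) c).symm
  have hBsymm : B.IsSymm := hB ▸ schoutenChange_isSymm hsymm.self_of_nhds (christoffel_symm hsymm)
    (partialD_conformalGradient_comm hw hw0) _
  rw [← sum_inv_mul_kulkarniNomizu hdet hBsymm, hraise, hraise]
  simp only [mul_riemann_conformal hG hw hw0 hsymm hdet, hB, mul_sub, Finset.sum_sub_distrib]

variable {G : EuclideanSpace ℝ (Fin 4) → Matrix (Fin 4) (Fin 4) ℝ}
  {w : EuclideanSpace ℝ (Fin 4) → ℝ} {y : EuclideanSpace ℝ (Fin 4)}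

theorem schouten_conformal (hG : ∀ i j, ContDiffAt ℝ 2 (fun z => G z i j) y)
    (hw : ContDiffAt ℝ 2 w y) (hw0 : w y ≠ 0) (hsymm : ∀ᶠ z in 𝓝 y, (G z).IsSymm)
    (hdet : IsUnit (G y).det) (a b : Fin 4) :
    schouten (fun z => (w z)⁻¹ ^ 2 • G z) y a b
      = schouten G y a b - schoutenChange (G y) (christoffel G)
        ((G y)⁻¹.mulVec (conformalGradient w y)) (conformalGradient w) y a b := by
  generalize hB : schoutenChange (G y) (christoffel G)
    ((G y)⁻¹.mulVec (conformalGradient w y)) (conformalGradient w) y = B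
  have htrace := sum_inv_mul_self hdet hsymm.self_of_nhds
  have hscalar : ricciScalar (fun z => (w z)⁻¹ ^ 2 • G z) y
      = w y ^ 2 * (ricciScalar G y - 6 * ∑ c, ∑ e, (G y)⁻¹ c e * B c e) := by
    simp only [ricciScalar, inv_smul_metric hw0 hdet, ricci_conformal hG hw hw0 hsymm hdet hB,
      Matrix.smul_apply, smul_eq_mul, mul_assoc, ← Finset.mul_sum, mul_sub, mul_add,
      Finset.sum_sub_distrib, Finset.sum_add_distrib, mul_left_comm ((G y)⁻¹ _ _)]
    rw [htrace]
    push_cast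
    ring
  simp only [schouten, hscalar, ricci_conformal hG hw hw0 hsymm hdet hB, Matrix.smul_apply,
    smul_eq_mul]
  push_cast
  field_simp
  ring

theorem weyl_conformal (hG : ∀ i j, ContDiffAt ℝ 2 (fun z => G z i j) y)
    (hw : ContDiffAt ℝ 2 w y) (hw0 : w y ≠ 0) (hsymm : ∀ᶠ z in 𝓝 y, (G z).IsSymm)
    (hdet : IsUnit (G y).det) (c d a b : Fin 4) :
    weyl (fun z => (w z)⁻¹ ^ 2 • G z) y c d a b = (w y)⁻¹ ^ 2 * weyl G y c d a b := by
  simp only [weyl, Matrix.smul_apply, smul_eq_mul, mul_assoc, ← Finset.mul_sum,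
    mul_riemann_conformal hG hw hw0 hsymm hdet, schouten_conformal hG hw hw0 hsymm hdet,
    kulkarniNomizu]
  ring

theorem weyl_of_ricci_eq_zero (hflat : ∀ a b, ricci G y a b = 0) (c d a b : Fin 4) :
    weyl G y c d a b = ∑ e, G y c e * riemann G y e d a b := by
  simp [weyl, schouten, ricciScalar, hflat]

theorem weyl_eq_of_conformal_ricci_eq_zero (hG : ∀ i j, ContDiffAt ℝ 2 (fun z => G z i j) y)
    (hw : ContDiffAt ℝ 2 w y) (hw0 : w y ≠ 0) (hsymm : ∀ᶠ z in 𝓝 y, (G z).IsSymm)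
    (hdet : IsUnit (G y).det) (hflat : ∀ a b, ricci (fun z => (w z)⁻¹ ^ 2 • G z) y a b = 0)
    (c d a b : Fin 4) :
    weyl G y c d a b = ∑ e, G y c e * riemann (fun z => (w z)⁻¹ ^ 2 • G z) y e d a b := by
  have hweyl := weyl_conformal hG hw hw0 hsymm hdet c d a b
  simp only [weyl_of_ricci_eq_zero hflat, Matrix.smul_apply, smul_eq_mul, mul_assoc,
    ← Finset.mul_sum] at hweyl
  exact (mul_left_cancel₀ (by positivity) hweyl).symm

end WeylTensor

section Congruence

variable {n : ℕ} {G G' : EuclideanSpace ℝ (Fin n) → Matrix (Fin n) (Fin n) ℝ}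
  {y : EuclideanSpace ℝ (Fin n)}

theorem christoffel_congr (h : G =ᶠ[𝓝 y] G') : christoffel G y = christoffel G' y := by
  have hd : ∀ k i j, partialD k (fun z => G z i j) y = partialD k (fun z => G' z i j) y :=
    fun k i j => partialD_congr (h.mono fun z hz => by simp only [hz])
  ext k i j
  simp only [christoffel, hd, h.eq_of_nhds]

theorem riemann_congr (h : G =ᶠ[𝓝 y] G') : riemann G y = riemann G' y :=
  curvature_congr (h.eventuallyEq_nhds.mono fun _ hz => christoffel_congr hz)

theorem ricci_congr (h : G =ᶠ[𝓝 y] G') : ricci G y = ricci G' y := by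
  ext d b
  simp only [ricci, riemann_congr h]

variable {G G' : EuclideanSpace ℝ (Fin 4) → Matrix (Fin 4) (Fin 4) ℝ}
  {w : EuclideanSpace ℝ (Fin 4) → ℝ} {y : EuclideanSpace ℝ (Fin 4)}

theorem weyl_congr (h : G =ᶠ[𝓝 y] G') : weyl G y = weyl G' y := by
  ext c d a b
  simp only [weyl, schouten, ricciScalar, ricci_congr h, riemann_congr h, h.eq_of_nhds]

theorem electricPart_congr (h : G =ᶠ[𝓝 y] G') (a b : Fin 4) :
    electricPart G w y a b = electricPart G' w y a b := by
  simp only [electricPart, weyl_congr h, h.eq_of_nhds]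

theorem magneticPart_congr (h : G =ᶠ[𝓝 y] G') (a b : Fin 4) :
    magneticPart G w y a b = magneticPart G' w y a b := by
  simp only [magneticPart, weylDual, weyl_congr h, h.eq_of_nhds]

end Congruence

section ProjectiveHessian

variable {n : ℕ} {K : EuclideanSpace ℝ (Fin n) → Fin n → Fin n → Fin n → ℝ}
  {w : EuclideanSpace ℝ (Fin n) → ℝ} {S : EuclideanSpace ℝ (Fin n) → Fin n → Fin n → ℝ}
  {y : EuclideanSpace ℝ (Fin n)}

/-- The tensor `∇ₐS_{bd} - ∇_bS_{ad}`, for `S` symmetric and a torsion-free connection `K`. It is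
the Cotton tensor of the projective class of `K` when `S` is its Schouten tensor. -/
def projectiveCotton (K : EuclideanSpace ℝ (Fin n) → Fin n → Fin n → Fin n → ℝ)
    (S : EuclideanSpace ℝ (Fin n) → Fin n → Fin n → ℝ) (y : EuclideanSpace ℝ (Fin n))
    (d a b : Fin n) : ℝ :=
  partialD a (fun z => S z b d) y - partialD b (fun z => S z a d) y
    + ∑ e, (S y a e * K y e b d - S y b e * K y e a d)

theorem projectiveSchouten_conformalGradient (hw : ContDiffAt ℝ 2 w y) (hw0 : w y ≠ 0) {i j : Fin n}
    {s : ℝ} (hess : partialD i (partialD j w) y + w y * s = ∑ e, partialD e w y * K y e i j) :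
    projectiveSchouten K (conformalGradient w) y i j = s := by
  have hsum : ∑ e, K y e i j * conformalGradient w y e
      = -((w y)⁻¹ * (partialD i (partialD j w) y + w y * s)) := by
    rw [hess, Finset.mul_sum, ← Finset.sum_neg_distrib]
    exact Finset.sum_congr rfl fun e _ => by rw [conformalGradient]; ring
  rw [projectiveSchouten, covectorD, hsum, partialD_conformalGradient hw hw0, conformalGradient,
    conformalGradient]
  field_simp
  ring

theorem sum_partialD_mul_partialD (hw : ContDiffAt ℝ 3 w y)
    (hK : ∀ c i j, DifferentiableAt ℝ (fun z => K z c i j) y)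
    (hS : ∀ i j, DifferentiableAt ℝ (fun z => S z i j) y)
    (hess : ∀ᶠ z in 𝓝 y, ∀ i j,
      partialD i (partialD j w) z + w z * S z i j = ∑ e, partialD e w z * K z e i j)
    (a i j : Fin n) :
    ∑ e, partialD e w y * partialD a (fun z => K z e i j) y
      = partialD a (partialD i (partialD j w)) y + partialD a w y * S y i j
        + w y * partialD a (fun z => S z i j) y
        - ∑ e, (∑ c, partialD c w y * K y c a e - w y * S y a e) * K y e i j := by
  have hw2 : ContDiffAt ℝ 2 w y := hw.of_le (by norm_num)
  have hdw : ∀ e, ContDiffAt ℝ 2 (partialD e w) y := fun e => contDiffAt_partialD hw (by norm_num)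
  have hderiv : partialD a (fun z => partialD i (partialD j w) z + w z * S z i j) y
      = partialD a (fun z => ∑ e, partialD e w z * K z e i j) y :=
    partialD_congr (hess.mono fun z hz => hz i j)
  rw [partialD_add (differentiableAt_partialD (hdw j))
      ((hw.differentiableAt (by norm_num)).fun_mul (hS i j)),
    partialD_mul (hw.differentiableAt (by norm_num)) (hS i j),
    partialD_sum fun e _ => (differentiableAt_partialD hw2).fun_mul (hK e i j)] at hderiv
  simp only [partialD_mul (differentiableAt_partialD hw2) (hK _ i j), Finset.sum_add_distrib,
    ← hess.self_of_nhds] at hderiv ⊢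
  simp only [add_sub_cancel_right]
  linarith

/-- Differentiating the Hessian equation expresses `∂_c w Rᶜ_{dab}` of `K` through `S`, and the
terms of order zero in `w` cancel those produced by the projective change. -/
theorem sum_mul_curvature_projectiveChange (hw : ContDiffAt ℝ 3 w y) (hw0 : w y ≠ 0)
    (hK : ∀ c i j, DifferentiableAt ℝ (fun z => K z c i j) y)
    (hsymm : ∀ c i j, K y c i j = K y c j i)
    (hS : ∀ i j, DifferentiableAt ℝ (fun z => S z i j) y)
    (hess : ∀ᶠ z in 𝓝 y, ∀ i j,
      partialD i (partialD j w) z + w z * S z i j = ∑ e, partialD e w z * K z e i j)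
    (d a b : Fin n) :
    ∑ c, partialD c w y * curvature (projectiveChange K (conformalGradient w)) y c d a b
      = w y * projectiveCotton K S y d a b := by
  have hw2 : ContDiffAt ℝ 2 w y := hw.of_le (by norm_num)
  have hchange := curvature_projectiveChange hK (differentiableAt_conformalGradient hw2 hw0) hsymm
    (partialD_conformalGradient_comm hw2 hw0)
  have hone : ∀ i, ∑ c, partialD c w y * (1 : Matrix (Fin n) (Fin n) ℝ) c i = partialD i w y :=
    fun i => by simp [Matrix.one_apply]
  have hquad : ∀ i j, ∑ c, partialD c w y * ∑ e, K y c i e * K y e j d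
      = ∑ e, (∑ c, partialD c w y * K y c i e) * K y e j d := fun i j => by
    simp only [Finset.mul_sum, Finset.sum_mul, ← mul_assoc]
    exact Finset.sum_comm
  have hcomm : partialD a (partialD b (partialD d w)) y
      = partialD b (partialD a (partialD d w)) y :=
    partialD_comm (contDiffAt_partialD hw (by norm_num)) a b
  have hthird := sum_partialD_mul_partialD hw hK hS hess
  simp only [hchange, projectiveSchouten_conformalGradient hw2 hw0 (hess.self_of_nhds _ _), mul_add,
    mul_sub, ← mul_assoc, Finset.sum_add_distrib, Finset.sum_sub_distrib, ← Finset.sum_mul, hone]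
  simp only [curvature, mul_add, mul_sub, Finset.sum_add_distrib, Finset.sum_sub_distrib, hquad,
    hthird]
  simp only [projectiveCotton, sub_mul, Finset.sum_sub_distrib, hcomm, mul_assoc, ← Finset.mul_sum]
  ring

end ProjectiveHessian

section SmoothExtension

variable {n : ℕ} {R : Set (EuclideanSpace ℝ (Fin n))} {y₀ : EuclideanSpace ℝ (Fin n)}
  {f g : EuclideanSpace ℝ (Fin n) → ℝ}

/-- Near `y₀`, the function `f` on the interior of `R` is the restriction of a function which is
smooth at `y₀` within `R`. The values of `f` outside the interior of `R` are irrelevant. -/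
@[fun_prop]
def ExtendsSmoothly (R : Set (EuclideanSpace ℝ (Fin n))) (y₀ : EuclideanSpace ℝ (Fin n))
    (f : EuclideanSpace ℝ (Fin n) → ℝ) : Prop :=
  ∃ F : EuclideanSpace ℝ (Fin n) → ℝ, ContDiffWithinAt ℝ ∞ F R y₀ ∧ f =ᶠ[𝓝[interior R] y₀] F

theorem eventually_eventually_nhds_of_nhdsWithin_interior {X : Type*} [TopologicalSpace X]
    {s : Set X} {x : X} {P : X → Prop} (h : ∀ᶠ y in 𝓝[interior s] x, P y) :
    ∀ᶠ y in 𝓝[interior s] x, ∀ᶠ z in 𝓝 y, P z := by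
  filter_upwards [eventually_eventually_nhdsWithin.2 h, self_mem_nhdsWithin] with y hy hys
  rwa [isOpen_interior.nhdsWithin_eq hys] at hy

namespace ExtendsSmoothly

theorem congr (hf : ExtendsSmoothly R y₀ f) (h : g =ᶠ[𝓝[interior R] y₀] f) :
    ExtendsSmoothly R y₀ g := by
  obtain ⟨F, hF, hfF⟩ := hf
  exact ⟨F, hF, h.trans hfF⟩

theorem of_contDiffWithinAt (hf : ContDiffWithinAt ℝ ∞ f R y₀) : ExtendsSmoothly R y₀ f :=
  ⟨f, hf, EventuallyEq.rfl⟩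

@[fun_prop]
theorem const (c : ℝ) : ExtendsSmoothly R y₀ fun _ => c :=
  of_contDiffWithinAt contDiffWithinAt_const

@[fun_prop]
theorem add (hf : ExtendsSmoothly R y₀ f) (hg : ExtendsSmoothly R y₀ g) :
    ExtendsSmoothly R y₀ fun y => f y + g y := by
  obtain ⟨F, hF, hfF⟩ := hf
  obtain ⟨G, hG, hgG⟩ := hg
  exact ⟨fun y => F y + G y, hF.add hG, hfF.add hgG⟩

@[fun_prop]
theorem mul (hf : ExtendsSmoothly R y₀ f) (hg : ExtendsSmoothly R y₀ g) :
    ExtendsSmoothly R y₀ fun y => f y * g y := by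
  obtain ⟨F, hF, hfF⟩ := hf
  obtain ⟨G, hG, hgG⟩ := hg
  exact ⟨fun y => F y * G y, hF.mul hG, hfF.mul hgG⟩

@[fun_prop]
theorem sub (hf : ExtendsSmoothly R y₀ f) (hg : ExtendsSmoothly R y₀ g) :
    ExtendsSmoothly R y₀ fun y => f y - g y := by
  obtain ⟨F, hF, hfF⟩ := hf
  obtain ⟨G, hG, hgG⟩ := hg
  exact ⟨fun y => F y - G y, hF.sub hG, hfF.sub hgG⟩

@[fun_prop]
theorem pow (hf : ExtendsSmoothly R y₀ f) (m : ℕ) : ExtendsSmoothly R y₀ fun y => f y ^ m := by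
  obtain ⟨F, hF, hfF⟩ := hf
  exact ⟨fun y => F y ^ m, hF.pow m, hfF.pow_const m⟩

@[fun_prop]
theorem sum {ι : Type*} [Fintype ι] {F : ι → EuclideanSpace ℝ (Fin n) → ℝ}
    (hF : ∀ i, ExtendsSmoothly R y₀ (F i)) : ExtendsSmoothly R y₀ fun y => ∑ i, F i y := by
  choose F' hF' hFF' using hF
  refine ⟨fun y => ∑ i, F' i y, ContDiffWithinAt.sum fun i _ => hF' i, ?_⟩
  filter_upwards [eventually_all.2 hFF'] with y hy
  exact Finset.sum_congr rfl fun i _ => hy i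

@[fun_prop]
theorem prod {ι : Type*} [Fintype ι] {F : ι → EuclideanSpace ℝ (Fin n) → ℝ}
    (hF : ∀ i, ExtendsSmoothly R y₀ (F i)) : ExtendsSmoothly R y₀ fun y => ∏ i, F i y := by
  choose F' hF' hFF' using hF
  refine ⟨fun y => ∏ i, F' i y, contDiffWithinAt_prod fun i _ => hF' i, ?_⟩
  filter_upwards [eventually_all.2 hFF'] with y hy
  exact Finset.prod_congr rfl fun i _ => hy i

theorem exists_tendsto (hf : ExtendsSmoothly R y₀ f) :
    ∃ c, Tendsto f (𝓝[interior R] y₀) (𝓝 c) := by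
  obtain ⟨F, hF, hfF⟩ := hf
  exact ⟨F y₀, (hF.continuousWithinAt.mono interior_subset).tendsto.congr' hfF.symm⟩

theorem eventually_differentiableAt (hf : ExtendsSmoothly R y₀ f) :
    ∀ᶠ y in 𝓝[interior R] y₀, DifferentiableAt ℝ f y := by
  obtain ⟨F, hF, hfF⟩ := hf
  have hF' : ∀ᶠ y in 𝓝[interior R] y₀, ContDiffWithinAt ℝ 1 F R y :=
    nhdsWithin_mono _ (interior_subset.trans (subset_insert _ _))
      ((hF.of_le ENat.LEInfty.out).eventually (by simp))
  filter_upwards [eventually_eventually_nhds_of_nhdsWithin_interior hfF, hF', self_mem_nhdsWithin]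
    with y hy hyF hyR
  exact ((hyF.contDiffAt (mem_interior_iff_mem_nhds.1 hyR)).differentiableAt
    (by norm_num)).congr_of_eventuallyEq hy

theorem tendsto_mul_zero (hf : ExtendsSmoothly R y₀ f) (hg : Tendsto g (𝓝[interior R] y₀) (𝓝 0)) :
    Tendsto (fun y => g y * f y) (𝓝[interior R] y₀) (𝓝 0) := by
  obtain ⟨c, hc⟩ := hf.exists_tendsto
  simpa only [zero_mul] using hg.mul hc

theorem inv [NeBot (𝓝[interior R] y₀)] (hf : ExtendsSmoothly R y₀ f) {c : ℝ}
    (h : Tendsto f (𝓝[interior R] y₀) (𝓝 c)) (hc : c ≠ 0) :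
    ExtendsSmoothly R y₀ fun y => (f y)⁻¹ := by
  obtain ⟨F, hF, hfF⟩ := hf
  have hFc : F y₀ = c := tendsto_nhds_unique
    ((hF.continuousWithinAt.mono interior_subset).tendsto.congr' hfF.symm) h
  exact ⟨fun y => (F y)⁻¹, hF.inv (hFc ▸ hc), hfF.mono fun y hy => congrArg (·⁻¹) hy⟩

theorem partialD (hf : ExtendsSmoothly R y₀ f) (hR : UniqueDiffOn ℝ R) (hy₀ : y₀ ∈ R) (k : Fin n) :
    ExtendsSmoothly R y₀ (partialD k f) := by
  obtain ⟨F, hF, hfF⟩ := hf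
  refine ⟨fun y => fderivWithin ℝ F R y (EuclideanSpace.single k 1),
    (hF.fderivWithin_right hR (by simp) hy₀).clm_apply contDiffWithinAt_const, ?_⟩
  filter_upwards [eventually_eventually_nhds_of_nhdsWithin_interior hfF, self_mem_nhdsWithin]
    with y hy hyR
  rw [partialD_congr hy, SpatialInfinity.partialD,
    fderivWithin_of_mem_nhds (mem_interior_iff_mem_nhds.1 hyR)]

variable {ι : Type*} [Fintype ι] [DecidableEq ι] {A : EuclideanSpace ℝ (Fin n) → Matrix ι ι ℝ}

theorem matrix_det (hA : ∀ i j, ExtendsSmoothly R y₀ fun y => A y i j) :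
    ExtendsSmoothly R y₀ fun y => (A y).det := by
  simp only [Matrix.det_apply']
  fun_prop

theorem matrix_inv [NeBot (𝓝[interior R] y₀)]
    (hA : ∀ i j, ExtendsSmoothly R y₀ fun y => A y i j) {c : ℝ}
    (h : Tendsto (fun y => (A y).det) (𝓝[interior R] y₀) (𝓝 c)) (hc : c ≠ 0) (i j : ι) :
    ExtendsSmoothly R y₀ fun y => (A y)⁻¹ i j := by
  simp only [Matrix.inv_def, Ring.inverse_eq_inv', Matrix.smul_apply, smul_eq_mul,
    Matrix.adjugate_apply]
  refine ((matrix_det hA).inv h hc).mul (matrix_det fun a b => ?_)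
  obtain rfl | haj := eq_or_ne a j
  · simpa only [Matrix.updateRow_self] using const _
  · simpa only [Matrix.updateRow_ne haj] using hA a b

end ExtendsSmoothly

end SmoothExtension

section RankOne

variable {ι : Type*} [Fintype ι] [DecidableEq ι] {A : Matrix ι ι ℝ} {α N : ι → ℝ} {μ : ℝ}

theorem inv_mulVec_eq_inv_smul (hA : IsUnit A.det) (hN : A.mulVec N = μ • α) (hμ : μ ≠ 0) :
    A⁻¹.mulVec α = μ⁻¹ • N := by
  rw [← one_smul ℝ α, ← inv_mul_cancel₀ hμ, mul_smul, ← hN, Matrix.mulVec_smul,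
    Matrix.mulVec_mulVec, Matrix.nonsing_inv_mul _ hA, Matrix.one_mulVec]

theorem inv_add_smul_vecMulVec (hA : IsUnit A.det) (hsymm : A.IsSymm) (hN : A.mulVec N = μ • α)
    (hμ : μ ≠ 0) {t : ℝ} (ht : μ + t * (α ⬝ᵥ N) ≠ 0) :
    (A + t • Matrix.vecMulVec α α)⁻¹
      = A⁻¹ - (t * μ⁻¹ * (μ + t * (α ⬝ᵥ N))⁻¹) • Matrix.vecMulVec N N := by
  have hinv := inv_mulVec_eq_inv_smul hA hN hμ
  have hNA : Matrix.vecMul N A = μ • α := by rw [← hN, ← Matrix.vecMul_transpose, hsymm.eq]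
  refine Matrix.inv_eq_left_inv ?_
  rw [sub_mul, mul_add, mul_add, Matrix.nonsing_inv_mul _ hA, Matrix.mul_smul,
    Matrix.mul_vecMulVec, hinv, Matrix.smul_mul, Matrix.vecMulVec_mul, hNA, Matrix.smul_mul,
    Matrix.mul_smul, Matrix.vecMulVec_mul_vecMulVec, dotProduct_comm N α]
  ext i j
  simp only [Matrix.add_apply, Matrix.sub_apply, Matrix.smul_apply, Matrix.vecMulVec_apply,
    smul_eq_mul, Pi.smul_apply]
  field_simp
  ring

theorem det_add_smul_vecMulVec (hA : IsUnit A.det) (hN : A.mulVec N = μ • α) (hμ : μ ≠ 0) (t : ℝ) :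
    (A + t • Matrix.vecMulVec α α).det = A.det * ((μ + t * (α ⬝ᵥ N)) * μ⁻¹) := by
  rw [← Matrix.smul_vecMulVec, Matrix.vecMulVec_eq Unit,
    Matrix.det_add_replicateCol_mul_replicateRow hA, Matrix.mul_assoc,
    ← Matrix.replicateCol_mulVec, Matrix.mulVec_smul, inv_mulVec_eq_inv_smul hA hN hμ]
  simp only [Matrix.det_unique, Matrix.add_apply, Matrix.one_apply_eq,
    Matrix.mul_apply, Matrix.replicateRow_apply, Matrix.replicateCol_apply, dotProduct,
    Pi.smul_apply, smul_eq_mul, add_mul, mul_inv_cancel₀ hμ, Finset.mul_sum, Finset.sum_mul]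
  exact congrArg _ (congrArg _ (Finset.sum_congr rfl fun _ _ => by ring))

end RankOne

section LocalAsymptote

variable {n : ℕ}

/-- The metric `w² g` expressed through `w` and `Q = w² (g + w⁻⁴ dw ⊗ dw)`. -/
def cylinderMetric (w : EuclideanSpace ℝ (Fin n) → ℝ)
    (Q : EuclideanSpace ℝ (Fin n) → Matrix (Fin n) (Fin n) ℝ) (y : EuclideanSpace ℝ (Fin n)) :
    Matrix (Fin n) (Fin n) ℝ :=
  Q y - (w y)⁻¹ ^ 2 • Matrix.vecMulVec (partialD · w y) (partialD · w y)

/-- Coordinate expressions `w`, `Q`, `N` of the fields `Ω`, `q`, `N` of an asymptote at spatial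
infinity, on a region `R` whose boundary points correspond to points at infinity. -/
structure LocalAsymptote (R : Set (EuclideanSpace ℝ (Fin n))) (w : EuclideanSpace ℝ (Fin n) → ℝ)
    (Q : EuclideanSpace ℝ (Fin n) → Matrix (Fin n) (Fin n) ℝ)
    (N : EuclideanSpace ℝ (Fin n) → EuclideanSpace ℝ (Fin n)) : Prop where
  uniqueDiffOn : UniqueDiffOn ℝ R
  contDiffOn_factor : ContDiffOn ℝ ∞ w R
  contDiffOn_metric : ∀ i j, ContDiffOn ℝ ∞ (fun y => Q y i j) R
  contDiffOn_normal : ContDiffOn ℝ ∞ N R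
  factor_ne_zero : ∀ y ∈ interior R, w y ≠ 0
  isSymm : ∀ y ∈ interior R, (Q y).IsSymm
  isUnit_det : ∀ y ∈ interior R, IsUnit (cylinderMetric w Q y).det
  mulVec_normal : ∀ y ∈ interior R,
    (cylinderMetric w Q y).mulVec (N y) = (w y)⁻¹ ^ 2 • (partialD · w y)

/-- The coefficient `σ` in `q(N, ·) = σ dΩ`, given by `dΩ(N) = -1 + Ω² σ`. -/
def normalFactor (w : EuclideanSpace ℝ (Fin n) → ℝ)
    (N : EuclideanSpace ℝ (Fin n) → EuclideanSpace ℝ (Fin n)) (y : EuclideanSpace ℝ (Fin n)) : ℝ :=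
  (w y)⁻¹ ^ 2 * (1 + (partialD · w y) ⬝ᵥ N y)

/-- The connection `Hᵏˡ Γ_{lij} - Nᵏ ∂ᵢ∂ⱼw + w Nᵏ Q_{ij}`, where `H` is the inverse of `w² g` and
`Γ_{lij}` the lowered Christoffel symbols of `Q`. It is a projective change of the Levi-Civita
connection of `g`, written in terms of fields which are smooth up to the boundary. -/
def extendedConnection (w : EuclideanSpace ℝ (Fin n) → ℝ)
    (Q : EuclideanSpace ℝ (Fin n) → Matrix (Fin n) (Fin n) ℝ)
    (N : EuclideanSpace ℝ (Fin n) → EuclideanSpace ℝ (Fin n)) (y : EuclideanSpace ℝ (Fin n))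
    (k i j : Fin n) : ℝ :=
  ∑ l, (cylinderMetric w Q y)⁻¹ k l * lowerChristoffel Q y l i j
    + N y k * (w y * Q y i j - partialD i (partialD j w) y)

/-- The projective Schouten tensor of `extendedConnection` relative to the conformal gradient of
`w`, written in terms of fields which are smooth up to the boundary. -/
def extendedSchouten (w : EuclideanSpace ℝ (Fin n) → ℝ)
    (Q : EuclideanSpace ℝ (Fin n) → Matrix (Fin n) (Fin n) ℝ)
    (N : EuclideanSpace ℝ (Fin n) → EuclideanSpace ℝ (Fin n)) (y : EuclideanSpace ℝ (Fin n))
    (i j : Fin n) : ℝ :=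
  w y * (∑ l, N y l * lowerChristoffel Q y l i j - normalFactor w N y * partialD i (partialD j w) y)
    + (-1 + w y ^ 2 * normalFactor w N y) * Q y i j

namespace LocalAsymptote

variable {R : Set (EuclideanSpace ℝ (Fin n))} {w : EuclideanSpace ℝ (Fin n) → ℝ}
  {Q : EuclideanSpace ℝ (Fin n) → Matrix (Fin n) (Fin n) ℝ}
  {N : EuclideanSpace ℝ (Fin n) → EuclideanSpace ℝ (Fin n)} {y : EuclideanSpace ℝ (Fin n)}

theorem contDiffAt_factor (h : LocalAsymptote R w Q N) (hy : y ∈ interior R) :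
    ContDiffAt ℝ ∞ w y :=
  h.contDiffOn_factor.contDiffAt (mem_interior_iff_mem_nhds.1 hy)

theorem contDiffAt_cylinderMetric (h : LocalAsymptote R w Q N) (hy : y ∈ interior R)
    (i j : Fin n) : ContDiffAt ℝ ∞ (fun z => cylinderMetric w Q z i j) y := by
  have hdw : ∀ k, ContDiffAt ℝ ∞ (partialD k w) y := fun k =>
    contDiffAt_partialD (h.contDiffAt_factor hy) (by simp)
  exact ((h.contDiffOn_metric i j).contDiffAt (mem_interior_iff_mem_nhds.1 hy)).sub
    ((((h.contDiffAt_factor hy).inv (h.factor_ne_zero y hy)).pow 2).mul ((hdw i).mul (hdw j)))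

theorem isSymm_cylinderMetric (h : LocalAsymptote R w Q N) (hy : y ∈ interior R) :
    (cylinderMetric w Q y).IsSymm :=
  (h.isSymm y hy).sub (Matrix.IsSymm.smul (Matrix.transpose_vecMulVec _ _) _)

theorem eventually_isSymm_cylinderMetric (h : LocalAsymptote R w Q N) (hy : y ∈ interior R) :
    ∀ᶠ z in 𝓝 y, (cylinderMetric w Q z).IsSymm :=
  (isOpen_interior.eventually_mem hy).mono fun _ => h.isSymm_cylinderMetric

theorem dotProduct_normal (h : LocalAsymptote R w Q N) (hy : y ∈ interior R) :
    (partialD · w y) ⬝ᵥ N y = -1 + w y ^ 2 * normalFactor w N y := by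
  have hw0 := h.factor_ne_zero y hy
  rw [normalFactor]
  field_simp
  ring

theorem mulVec_normal_eq_normalFactor_smul (h : LocalAsymptote R w Q N) (hy : y ∈ interior R) :
    (Q y).mulVec (N y) = normalFactor w N y • (partialD · w y) := by
  have hN := h.mulVec_normal y hy
  rw [cylinderMetric, Matrix.sub_mulVec, Matrix.smul_mulVec, Matrix.vecMulVec_mulVec,
    sub_eq_iff_eq_add] at hN
  rw [hN, normalFactor]
  ext i
  simp only [Pi.add_apply, Pi.smul_apply, smul_eq_mul, MulOpposite.smul_eq_mul_unop,
    MulOpposite.unop_op]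
  ring

theorem inv_mulVec_partialD (h : LocalAsymptote R w Q N) (hy : y ∈ interior R) :
    (cylinderMetric w Q y)⁻¹.mulVec (partialD · w y) = w y ^ 2 • N y := by
  have hw0 := h.factor_ne_zero y hy
  rw [inv_mulVec_eq_inv_smul (h.isUnit_det y hy) (h.mulVec_normal y hy) (by positivity), inv_pow,
    inv_inv]

theorem sum_partialD_mul_inv (h : LocalAsymptote R w Q N) (hy : y ∈ interior R) (l : Fin n) :
    ∑ k, partialD k w y * (cylinderMetric w Q y)⁻¹ k l = w y ^ 2 * N y l := by
  refine Eq.trans (Finset.sum_congr rfl fun k _ => ?_) (congrFun (h.inv_mulVec_partialD hy) l)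
  rw [(h.isSymm_cylinderMetric hy).inv.apply, mul_comm]

theorem lowerChristoffel_cylinderMetric (h : LocalAsymptote R w Q N) (hy : y ∈ interior R)
    (l i j : Fin n) :
    lowerChristoffel (cylinderMetric w Q) y l i j = lowerChristoffel Q y l i j
      + partialD l w y * ((w y)⁻¹ ^ 3 * (partialD i w y * partialD j w y)
        - (w y)⁻¹ ^ 2 * partialD i (partialD j w) y) := by
  have hw0 := h.factor_ne_zero y hy
  have hw : ContDiffAt ℝ 2 w y := (h.contDiffAt_factor hy).of_le ENat.LEInfty.out
  have hdiff := hw.differentiableAt (by norm_num)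
  have hderiv : ∀ k a b, partialD k (fun z => cylinderMetric w Q z a b) y
      = partialD k (fun z => Q z a b) y
        + 2 * (w y)⁻¹ ^ 3 * partialD k w y * partialD a w y * partialD b w y
        - (w y)⁻¹ ^ 2 * (partialD k (partialD a w) y * partialD b w y
          + partialD a w y * partialD k (partialD b w) y) := by
    intro k a b
    have hinv := hdiff.fun_inv hw0
    have hdw := fun e : Fin n => differentiableAt_partialD (k := e) hw
    have hQ : DifferentiableAt ℝ (fun z => Q z a b) y :=
      ((h.contDiffOn_metric a b).contDiffAt (mem_interior_iff_mem_nhds.1 hy)).differentiableAt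
        (by simp)
    simp only [cylinderMetric, Matrix.sub_apply, Matrix.smul_apply, Matrix.vecMulVec_apply,
      smul_eq_mul, pow_two]
    rw [partialD_sub hQ ((hinv.fun_mul hinv).fun_mul ((hdw a).fun_mul (hdw b))),
      partialD_mul (hinv.fun_mul hinv) ((hdw a).fun_mul (hdw b)), partialD_mul hinv hinv,
      partialD_inv hdiff hw0, partialD_mul (hdw a) (hdw b)]
    ring
  simp only [lowerChristoffel, hderiv, partialD_comm hw l i, partialD_comm hw l j,
    partialD_comm hw j i]
  ring

theorem metricChange_christoffel_cylinderMetric (h : LocalAsymptote R w Q N)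
    (hy : y ∈ interior R) :
    metricChange (christoffel (cylinderMetric w Q))
      (fun z => (cylinderMetric w Q z)⁻¹.mulVec (conformalGradient w z)) (cylinderMetric w Q) y
      = extendedConnection w Q N y := by
  have hw0 := h.factor_ne_zero y hy
  have hraise : ∀ k, ∑ l, (cylinderMetric w Q y)⁻¹ k l * partialD l w y = w y ^ 2 * N y k :=
    fun k => congrFun (h.inv_mulVec_partialD hy) k
  have hgrad : (cylinderMetric w Q y)⁻¹.mulVec (conformalGradient w y) = -(w y • N y) := by
    rw [show conformalGradient w y = -(w y)⁻¹ • (partialD · w y) by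
      ext i; simp [conformalGradient], Matrix.mulVec_smul, h.inv_mulVec_partialD hy]
    ext i
    simp only [Pi.smul_apply, Pi.neg_apply, smul_eq_mul]
    field_simp
  ext k i j
  simp only [metricChange, hgrad, christoffel_eq_sum, h.lowerChristoffel_cylinderMetric hy,
    extendedConnection, mul_add, Finset.sum_add_distrib, ← mul_assoc, ← Finset.sum_mul, hraise]
  simp only [cylinderMetric, Matrix.sub_apply, Matrix.smul_apply, Matrix.vecMulVec_apply,
    Pi.neg_apply, Pi.smul_apply, smul_eq_mul]
  field_simp
  ring

theorem hessian_eq (h : LocalAsymptote R w Q N) (hy : y ∈ interior R) (i j : Fin n) :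
    partialD i (partialD j w) y + w y * extendedSchouten w Q N y i j
      = ∑ e, partialD e w y * extendedConnection w Q N y e i j := by
  have hswap : ∑ e, partialD e w y
        * ∑ l, (cylinderMetric w Q y)⁻¹ e l * lowerChristoffel Q y l i j
      = w y ^ 2 * ∑ l, N y l * lowerChristoffel Q y l i j := by
    simp only [Finset.mul_sum, ← mul_assoc]
    rw [Finset.sum_comm]
    simp only [← Finset.sum_mul, h.sum_partialD_mul_inv hy]
  have hN : ∑ e, partialD e w y * N y e = -1 + w y ^ 2 * normalFactor w N y :=
    h.dotProduct_normal hy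
  simp only [extendedConnection, mul_add, Finset.sum_add_distrib, hswap]
  simp only [← mul_assoc, ← Finset.sum_mul, hN, extendedSchouten]
  ring

theorem riemann_eq_curvature (h : LocalAsymptote R w Q N) (hy : y ∈ interior R) :
    riemann (fun z => (w z)⁻¹ ^ 2 • cylinderMetric w Q z) y
      = curvature (projectiveChange (extendedConnection w Q N) (conformalGradient w)) y := by
  rw [riemann_conformal (fun i j => (h.contDiffAt_cylinderMetric hy i j).of_le ENat.LEInfty.out)
    ((h.contDiffAt_factor hy).of_le ENat.LEInfty.out) (h.factor_ne_zero y hy)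
    (h.isUnit_det y hy)]
  refine curvature_congr ?_
  filter_upwards [isOpen_interior.mem_nhds hy] with z hz
  ext c i j
  simp only [projectiveChange, h.metricChange_christoffel_cylinderMetric hz]

theorem extendedConnection_symm (h : LocalAsymptote R w Q N) (hy : y ∈ interior R)
    (k i j : Fin n) : extendedConnection w Q N y k i j = extendedConnection w Q N y k j i := by
  have hsymm : ∀ l, lowerChristoffel Q y l i j = lowerChristoffel Q y l j i := fun l => by
    rw [lowerChristoffel, lowerChristoffel, partialD_symm (G := Q)
      ((isOpen_interior.eventually_mem hy).mono fun z => h.isSymm z) l i j]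
    ring
  rw [extendedConnection, extendedConnection, (h.isSymm y hy).apply,
    partialD_comm ((h.contDiffAt_factor hy).of_le ENat.LEInfty.out) i j]
  simp only [hsymm]

end LocalAsymptote

end LocalAsymptote

section Boundary

variable {n : ℕ}

/-- The limit of the components `∂ᵢw` at the boundary point `y₀` of `R`. -/
def boundaryConormal (R : Set (EuclideanSpace ℝ (Fin n))) (w : EuclideanSpace ℝ (Fin n) → ℝ)
    (y₀ : EuclideanSpace ℝ (Fin n)) (i : Fin n) : ℝ :=
  fderivWithin ℝ w R y₀ (EuclideanSpace.single i 1)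

/-- `y₀` corresponds to a point at infinity of the asymptote `w`, `Q`, `N`: there `w` vanishes to
first order, and `Q` is nondegenerate on the kernel of `dw`. -/
structure LocalAsymptoteAt (R : Set (EuclideanSpace ℝ (Fin n)))
    (w : EuclideanSpace ℝ (Fin n) → ℝ)
    (Q : EuclideanSpace ℝ (Fin n) → Matrix (Fin n) (Fin n) ℝ)
    (N : EuclideanSpace ℝ (Fin n) → EuclideanSpace ℝ (Fin n))
    (y₀ : EuclideanSpace ℝ (Fin n)) : Prop extends LocalAsymptote R w Q N where
  mem : y₀ ∈ R
  neBot : NeBot (𝓝[interior R] y₀)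
  factor_eq_zero : w y₀ = 0
  boundaryConormal_ne_zero : boundaryConormal R w y₀ ≠ 0
  nondegenerate : ∀ v, boundaryConormal R w y₀ ⬝ᵥ v = 0 →
    (∀ u, boundaryConormal R w y₀ ⬝ᵥ u = 0 → u ⬝ᵥ (Q y₀).mulVec v = 0) → v = 0

/-- The modification `Q + (1 + σ) dw ⊗ dw` of the metric `w² g` which stays nondegenerate at the
boundary. -/
def transverseMetric (w : EuclideanSpace ℝ (Fin n) → ℝ)
    (Q : EuclideanSpace ℝ (Fin n) → Matrix (Fin n) (Fin n) ℝ)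
    (N : EuclideanSpace ℝ (Fin n) → EuclideanSpace ℝ (Fin n)) (y : EuclideanSpace ℝ (Fin n)) :
    Matrix (Fin n) (Fin n) ℝ :=
  Q y + (1 + normalFactor w N y) • Matrix.vecMulVec (partialD · w y) (partialD · w y)

/-- The coefficient `μ` in `A N = μ dw`, where `A` is `transverseMetric`. -/
def transverseFactor (w : EuclideanSpace ℝ (Fin n) → ℝ)
    (N : EuclideanSpace ℝ (Fin n) → EuclideanSpace ℝ (Fin n)) (y : EuclideanSpace ℝ (Fin n)) : ℝ :=
  -1 + w y ^ 2 * (normalFactor w N y * (1 + normalFactor w N y))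

variable {R : Set (EuclideanSpace ℝ (Fin n))} {w : EuclideanSpace ℝ (Fin n) → ℝ}
  {Q : EuclideanSpace ℝ (Fin n) → Matrix (Fin n) (Fin n) ℝ}
  {N : EuclideanSpace ℝ (Fin n) → EuclideanSpace ℝ (Fin n)} {y y₀ : EuclideanSpace ℝ (Fin n)}

namespace LocalAsymptote

theorem isSymm_transverseMetric (h : LocalAsymptote R w Q N) (hy : y ∈ interior R) :
    (transverseMetric w Q N y).IsSymm :=
  (h.isSymm y hy).add (Matrix.IsSymm.smul (Matrix.transpose_vecMulVec _ _) _)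

theorem transverseMetric_mulVec_normal (h : LocalAsymptote R w Q N) (hy : y ∈ interior R) :
    (transverseMetric w Q N y).mulVec (N y) = transverseFactor w N y • (partialD · w y) := by
  rw [transverseMetric, Matrix.add_mulVec, Matrix.smul_mulVec, Matrix.vecMulVec_mulVec,
    h.mulVec_normal_eq_normalFactor_smul hy, h.dotProduct_normal hy, transverseFactor]
  ext i
  simp only [Pi.add_apply, Pi.smul_apply, smul_eq_mul, MulOpposite.smul_eq_mul_unop,
    MulOpposite.unop_op]
  ring

theorem cylinderMetric_eq_transverseMetric_add :
    cylinderMetric w Q y = transverseMetric w Q N y + (-((w y)⁻¹ ^ 2 + 1 + normalFactor w N y))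
      • Matrix.vecMulVec (partialD · w y) (partialD · w y) := by
  rw [cylinderMetric, transverseMetric]
  module

theorem transverseFactor_add (h : LocalAsymptote R w Q N) (hy : y ∈ interior R) :
    transverseFactor w N y + -((w y)⁻¹ ^ 2 + 1 + normalFactor w N y) * ((partialD · w y) ⬝ᵥ N y)
      = (w y)⁻¹ ^ 2 := by
  have hw0 := h.factor_ne_zero y hy
  rw [h.dotProduct_normal hy, transverseFactor]
  field_simp
  ring

theorem inv_cylinderMetric (h : LocalAsymptote R w Q N) (hy : y ∈ interior R)
    (hdet : IsUnit (transverseMetric w Q N y).det) (hμ : transverseFactor w N y ≠ 0) :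
    (cylinderMetric w Q y)⁻¹ = (transverseMetric w Q N y)⁻¹
      + ((1 + w y ^ 2 * (1 + normalFactor w N y)) * (transverseFactor w N y)⁻¹)
        • Matrix.vecMulVec (N y) (N y) := by
  have hw0 := h.factor_ne_zero y hy
  have hsum := h.transverseFactor_add hy
  rw [cylinderMetric_eq_transverseMetric_add (N := N), inv_add_smul_vecMulVec hdet
    (h.isSymm_transverseMetric hy) (h.transverseMetric_mulVec_normal hy) hμ
    (by rw [hsum]; positivity), hsum, sub_eq_add_neg, ← neg_smul]
  congr 2
  field_simp
  ring

theorem sq_mul_det_cylinderMetric (h : LocalAsymptote R w Q N) (hy : y ∈ interior R)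
    (hdet : IsUnit (transverseMetric w Q N y).det) (hμ : transverseFactor w N y ≠ 0) :
    w y ^ 2 * (cylinderMetric w Q y).det
      = (transverseMetric w Q N y).det * (transverseFactor w N y)⁻¹ := by
  have hw0 := h.factor_ne_zero y hy
  rw [cylinderMetric_eq_transverseMetric_add (N := N), det_add_smul_vecMulVec hdet
    (h.transverseMetric_mulVec_normal hy) hμ, h.transverseFactor_add hy]
  field_simp

end LocalAsymptote

namespace LocalAsymptoteAt

theorem extendsSmoothly_factor (h : LocalAsymptoteAt R w Q N y₀) : ExtendsSmoothly R y₀ w :=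
  .of_contDiffWithinAt (h.contDiffOn_factor y₀ h.mem)

theorem extendsSmoothly_metric (h : LocalAsymptoteAt R w Q N y₀) (i j : Fin n) :
    ExtendsSmoothly R y₀ fun y => Q y i j :=
  .of_contDiffWithinAt (h.contDiffOn_metric i j y₀ h.mem)

theorem extendsSmoothly_normal (h : LocalAsymptoteAt R w Q N y₀) (i : Fin n) :
    ExtendsSmoothly R y₀ fun y => N y i :=
  .of_contDiffWithinAt ((contDiffWithinAt_piLp 2).1 (h.contDiffOn_normal y₀ h.mem) i)

theorem extendsSmoothly_partialD (h : LocalAsymptoteAt R w Q N y₀)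
    {f : EuclideanSpace ℝ (Fin n) → ℝ} (hf : ExtendsSmoothly R y₀ f) (k : Fin n) :
    ExtendsSmoothly R y₀ (partialD k f) :=
  hf.partialD h.uniqueDiffOn h.mem k

theorem tendsto_factor (h : LocalAsymptoteAt R w Q N y₀) :
    Tendsto w (𝓝[interior R] y₀) (𝓝 0) :=
  h.factor_eq_zero ▸
    ((h.contDiffOn_factor y₀ h.mem).continuousWithinAt.mono interior_subset).tendsto

theorem tendsto_partialD_factor (h : LocalAsymptoteAt R w Q N y₀) (i : Fin n) :
    Tendsto (partialD i w) (𝓝[interior R] y₀) (𝓝 (boundaryConormal R w y₀ i)) := by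
  have hcont : ContinuousWithinAt
      (fun y => fderivWithin ℝ w R y (EuclideanSpace.single i 1)) R y₀ :=
    (((h.contDiffOn_factor y₀ h.mem).fderivWithin_right (m := 0) h.uniqueDiffOn (by simp)
      h.mem).clm_apply contDiffWithinAt_const).continuousWithinAt
  refine (hcont.mono interior_subset).tendsto.congr' ?_
  filter_upwards [self_mem_nhdsWithin] with y hy
  rw [partialD, fderivWithin_of_mem_nhds (mem_interior_iff_mem_nhds.1 hy)]

theorem extendsSmoothly_normalFactor (h : LocalAsymptoteAt R w Q N y₀) :
    ExtendsSmoothly R y₀ (normalFactor w N) := by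
  have := h.neBot
  obtain ⟨i, hi⟩ := Function.ne_iff.1 h.boundaryConormal_ne_zero
  have hdw := h.extendsSmoothly_partialD h.extendsSmoothly_factor i
  have hquot : ExtendsSmoothly R y₀ fun y => (∑ j, Q y i j * N y j) * (partialD i w y)⁻¹ :=
    .mul (.sum fun j => (h.extendsSmoothly_metric i j).mul (h.extendsSmoothly_normal j))
      (hdw.inv (h.tendsto_partialD_factor i) hi)
  refine hquot.congr ?_
  filter_upwards [self_mem_nhdsWithin, (h.tendsto_partialD_factor i).eventually_ne hi] with y hy hne
  have hi : ∑ j, Q y i j * N y j = normalFactor w N y * partialD i w y :=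
    congrFun (h.mulVec_normal_eq_normalFactor_smul hy) i
  rw [hi, mul_inv_cancel_right₀ hne]

theorem extendsSmoothly_transverseFactor (h : LocalAsymptoteAt R w Q N y₀) :
    ExtendsSmoothly R y₀ (transverseFactor w N) := by
  have hw := h.extendsSmoothly_factor
  have hσ := h.extendsSmoothly_normalFactor
  unfold transverseFactor
  fun_prop

theorem tendsto_sq_mul (h : LocalAsymptoteAt R w Q N y₀) {f : EuclideanSpace ℝ (Fin n) → ℝ}
    (hf : ExtendsSmoothly R y₀ f) :
    Tendsto (fun y => w y ^ 2 * f y) (𝓝[interior R] y₀) (𝓝 0) :=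
  hf.tendsto_mul_zero (by simpa using h.tendsto_factor.pow 2)

theorem tendsto_transverseFactor (h : LocalAsymptoteAt R w Q N y₀) :
    Tendsto (transverseFactor w N) (𝓝[interior R] y₀) (𝓝 (-1)) := by
  have hσ := h.extendsSmoothly_normalFactor
  have hσσ := hσ.mul ((ExtendsSmoothly.const 1).add hσ)
  simpa only [transverseFactor, add_zero] using! tendsto_const_nhds.add (h.tendsto_sq_mul hσσ)

theorem extendsSmoothly_transverseMetric (h : LocalAsymptoteAt R w Q N y₀) (i j : Fin n) :
    ExtendsSmoothly R y₀ fun y => transverseMetric w Q N y i j := by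
  have hσ := h.extendsSmoothly_normalFactor
  have hdw := fun k => h.extendsSmoothly_partialD h.extendsSmoothly_factor k
  exact (h.extendsSmoothly_metric i j).add
    (((ExtendsSmoothly.const 1).add hσ).mul ((hdw i).mul (hdw j)))

theorem exists_tendsto_transverseMetric (h : LocalAsymptoteAt R w Q N y₀) :
    ∃ s : ℝ, Tendsto (transverseMetric w Q N) (𝓝[interior R] y₀) (𝓝 (Q y₀ + s
      • Matrix.vecMulVec (boundaryConormal R w y₀) (boundaryConormal R w y₀))) := by
  obtain ⟨σ, hσ⟩ := h.extendsSmoothly_normalFactor.exists_tendsto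
  refine ⟨1 + σ, tendsto_pi_nhds.2 fun i => tendsto_pi_nhds.2 fun j => ?_⟩
  have hQ := ((h.contDiffOn_metric i j y₀ h.mem).continuousWithinAt.mono interior_subset).tendsto
  exact hQ.add ((tendsto_const_nhds.add hσ).mul
    ((h.tendsto_partialD_factor i).mul (h.tendsto_partialD_factor j)))

theorem boundaryConormal_dotProduct_eq_zero (h : LocalAsymptoteAt R w Q N y₀)
    {A : Matrix (Fin n) (Fin n) ℝ}
    (hA : Tendsto (transverseMetric w Q N) (𝓝[interior R] y₀) (𝓝 A)) {v : Fin n → ℝ}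
    (hv : A.mulVec v = 0) : boundaryConormal R w y₀ ⬝ᵥ v = 0 := by
  have := h.neBot
  have hN : Tendsto (fun y => (N y : Fin n → ℝ)) (𝓝[interior R] y₀) (𝓝 (N y₀)) :=
    ((PiLp.continuous_ofLp 2 _).tendsto _).comp
      ((h.contDiffOn_normal y₀ h.mem).continuousWithinAt.mono interior_subset).tendsto
  have hdw : Tendsto (fun y => (partialD · w y)) (𝓝[interior R] y₀) (𝓝 (boundaryConormal R w y₀)) :=
    tendsto_pi_nhds.2 h.tendsto_partialD_factor
  have hleft : Tendsto (fun y => (N y : Fin n → ℝ) ⬝ᵥ (transverseMetric w Q N y).mulVec v)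
      (𝓝[interior R] y₀) (𝓝 ((N y₀ : Fin n → ℝ) ⬝ᵥ A.mulVec v)) :=
    ((continuous_fst.dotProduct (continuous_snd.matrix_mulVec continuous_const)).tendsto
      ((N y₀ : Fin n → ℝ), A)).comp (hN.prodMk_nhds hA)
  have hright : Tendsto (fun y => transverseFactor w N y * ((partialD · w y) ⬝ᵥ v))
      (𝓝[interior R] y₀) (𝓝 (-1 * (boundaryConormal R w y₀ ⬝ᵥ v))) :=
    h.tendsto_transverseFactor.mul
      (((continuous_id.dotProduct continuous_const).tendsto _).comp hdw)
  have heq : ∀ y ∈ interior R, (N y : Fin n → ℝ) ⬝ᵥ (transverseMetric w Q N y).mulVec v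
      = transverseFactor w N y * ((partialD · w y) ⬝ᵥ v) := fun y hy => by
    rw [Matrix.dotProduct_mulVec, ← Matrix.mulVec_transpose, (h.isSymm_transverseMetric hy).eq,
      h.transverseMetric_mulVec_normal hy, smul_dotProduct, smul_eq_mul]
  have hlim := tendsto_nhds_unique (hleft.congr' (eventually_nhdsWithin_of_forall heq)) hright
  rw [hv, dotProduct_zero] at hlim
  linarith

theorem exists_tendsto_det_transverseMetric (h : LocalAsymptoteAt R w Q N y₀) :
    ∃ c : ℝ, c ≠ 0 ∧
      Tendsto (fun y => (transverseMetric w Q N y).det) (𝓝[interior R] y₀) (𝓝 c) := by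
  obtain ⟨s, hs⟩ := h.exists_tendsto_transverseMetric
  refine ⟨_, fun hdet => ?_, (continuous_id.matrix_det.tendsto _).comp hs⟩
  obtain ⟨v, hv, hker⟩ := Matrix.exists_mulVec_eq_zero_iff.2 hdet
  have hαv := h.boundaryConormal_dotProduct_eq_zero hs hker
  rw [id, Matrix.add_mulVec, Matrix.smul_mulVec, Matrix.vecMulVec_mulVec, hαv,
    MulOpposite.op_zero, zero_smul, smul_zero, add_zero] at hker
  exact hv (h.nondegenerate v hαv fun u _ => by rw [hker, dotProduct_zero])

theorem eventually_isUnit_det_transverseMetric (h : LocalAsymptoteAt R w Q N y₀) :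
    ∀ᶠ y in 𝓝[interior R] y₀, IsUnit (transverseMetric w Q N y).det := by
  obtain ⟨c, hc, hdet⟩ := h.exists_tendsto_det_transverseMetric
  exact (hdet.eventually_ne hc).mono fun _ hy => hy.isUnit

theorem extendsSmoothly_inv_cylinderMetric (h : LocalAsymptoteAt R w Q N y₀) (i j : Fin n) :
    ExtendsSmoothly R y₀ fun y => (cylinderMetric w Q y)⁻¹ i j := by
  have := h.neBot
  obtain ⟨c, hc, hdet⟩ := h.exists_tendsto_det_transverseMetric
  have hw := h.extendsSmoothly_factor
  have hσ := h.extendsSmoothly_normalFactor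
  have hN := h.extendsSmoothly_normal
  have hμ := h.extendsSmoothly_transverseFactor.inv h.tendsto_transverseFactor (by norm_num)
  have hA := ExtendsSmoothly.matrix_inv h.extendsSmoothly_transverseMetric hdet hc i j
  have hG : ExtendsSmoothly R y₀ fun y => (transverseMetric w Q N y)⁻¹ i j
      + (1 + w y ^ 2 * (1 + normalFactor w N y)) * (transverseFactor w N y)⁻¹
        * (N y i * N y j) := by
    fun_prop
  refine hG.congr ?_
  filter_upwards [self_mem_nhdsWithin, h.eventually_isUnit_det_transverseMetric,
    h.tendsto_transverseFactor.eventually_ne (by norm_num : (-1 : ℝ) ≠ 0)] with y hy hunit hne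
  rw [h.inv_cylinderMetric hy hunit hne]
  rfl

theorem extendsSmoothly_sq_mul_det_cylinderMetric (h : LocalAsymptoteAt R w Q N y₀) :
    ExtendsSmoothly R y₀ fun y => w y ^ 2 * (cylinderMetric w Q y).det := by
  have := h.neBot
  refine (ExtendsSmoothly.mul (.matrix_det h.extendsSmoothly_transverseMetric)
    (h.extendsSmoothly_transverseFactor.inv h.tendsto_transverseFactor (by norm_num))).congr ?_
  filter_upwards [self_mem_nhdsWithin, h.eventually_isUnit_det_transverseMetric,
    h.tendsto_transverseFactor.eventually_ne (by norm_num : (-1 : ℝ) ≠ 0)] with y hy hunit hne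
  exact h.sq_mul_det_cylinderMetric hy hunit hne

end LocalAsymptoteAt

end Boundary

section ExtendedCurvature

variable {n : ℕ} {R : Set (EuclideanSpace ℝ (Fin n))} {w : EuclideanSpace ℝ (Fin n) → ℝ}
  {Q : EuclideanSpace ℝ (Fin n) → Matrix (Fin n) (Fin n) ℝ}
  {N : EuclideanSpace ℝ (Fin n) → EuclideanSpace ℝ (Fin n)} {y₀ : EuclideanSpace ℝ (Fin n)}

namespace LocalAsymptoteAt

theorem extendsSmoothly_lowerChristoffel (h : LocalAsymptoteAt R w Q N y₀) (l i j : Fin n) :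
    ExtendsSmoothly R y₀ fun y => lowerChristoffel Q y l i j := by
  have hQ := fun k a b => h.extendsSmoothly_partialD (h.extendsSmoothly_metric a b) k
  exact (ExtendsSmoothly.const _).mul (((hQ i l j).add (hQ j l i)).sub (hQ l i j))

theorem extendsSmoothly_partialD_partialD (h : LocalAsymptoteAt R w Q N y₀) (i j : Fin n) :
    ExtendsSmoothly R y₀ (partialD i (partialD j w)) :=
  h.extendsSmoothly_partialD (h.extendsSmoothly_partialD h.extendsSmoothly_factor j) i

theorem extendsSmoothly_extendedConnection (h : LocalAsymptoteAt R w Q N y₀) (k i j : Fin n) :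
    ExtendsSmoothly R y₀ fun y => extendedConnection w Q N y k i j :=
  .add (.sum fun l => (h.extendsSmoothly_inv_cylinderMetric k l).mul
      (h.extendsSmoothly_lowerChristoffel l i j))
    ((h.extendsSmoothly_normal k).mul ((h.extendsSmoothly_factor.mul
      (h.extendsSmoothly_metric i j)).sub (h.extendsSmoothly_partialD_partialD i j)))

theorem extendsSmoothly_extendedSchouten (h : LocalAsymptoteAt R w Q N y₀) (i j : Fin n) :
    ExtendsSmoothly R y₀ fun y => extendedSchouten w Q N y i j := by
  have hσ := h.extendsSmoothly_normalFactor
  have hw := h.extendsSmoothly_factor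
  exact (hw.mul ((ExtendsSmoothly.sum fun l => (h.extendsSmoothly_normal l).mul
      (h.extendsSmoothly_lowerChristoffel l i j)).sub
      (hσ.mul (h.extendsSmoothly_partialD_partialD i j)))).add
    (((ExtendsSmoothly.const _).add ((hw.pow 2).mul hσ)).mul (h.extendsSmoothly_metric i j))

theorem extendsSmoothly_curvature_extendedConnection (h : LocalAsymptoteAt R w Q N y₀)
    (c d a b : Fin n) :
    ExtendsSmoothly R y₀ fun y => curvature (extendedConnection w Q N) y c d a b := by
  have hK := h.extendsSmoothly_extendedConnection
  have hdK := fun k e i j => h.extendsSmoothly_partialD (hK e i j) k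
  exact ((hdK a c b d).sub (hdK b c a d)).add (.sum fun e =>
    ((hK c a e).mul (hK e b d)).sub ((hK c b e).mul (hK e a d)))

theorem extendsSmoothly_projectiveCotton (h : LocalAsymptoteAt R w Q N y₀) (d a b : Fin n) :
    ExtendsSmoothly R y₀ fun y =>
      projectiveCotton (extendedConnection w Q N) (extendedSchouten w Q N) y d a b := by
  have hK := h.extendsSmoothly_extendedConnection
  have hS := h.extendsSmoothly_extendedSchouten
  exact ((h.extendsSmoothly_partialD (hS b d) a).sub (h.extendsSmoothly_partialD (hS a d) b)).add
    (.sum fun e => ((hS a e).mul (hK e b d)).sub ((hS b e).mul (hK e a d)))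

theorem eventually_differentiableAt_extendedConnection (h : LocalAsymptoteAt R w Q N y₀) :
    ∀ᶠ y in 𝓝[interior R] y₀, ∀ k i j,
      DifferentiableAt ℝ (fun z => extendedConnection w Q N z k i j) y :=
  eventually_all.2 fun k => eventually_all.2 fun i => eventually_all.2 fun j =>
    (h.extendsSmoothly_extendedConnection k i j).eventually_differentiableAt

theorem extendsSmoothly_riemann (h : LocalAsymptoteAt R w Q N y₀) (c d a b : Fin n) :
    ExtendsSmoothly R y₀ fun y =>
      riemann (fun z => (w z)⁻¹ ^ 2 • cylinderMetric w Q z) y c d a b := by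
  have hS := h.extendsSmoothly_extendedSchouten
  refine (((h.extendsSmoothly_curvature_extendedConnection c d a b).add
    ((ExtendsSmoothly.const ((1 : Matrix (Fin n) (Fin n) ℝ) c b)).mul (hS a d))).sub
    ((ExtendsSmoothly.const ((1 : Matrix (Fin n) (Fin n) ℝ) c a)).mul (hS b d))).congr ?_
  filter_upwards [self_mem_nhdsWithin, h.eventually_differentiableAt_extendedConnection]
    with y hy hK
  have hw : ContDiffAt ℝ 2 w y := (h.contDiffAt_factor hy).of_le ENat.LEInfty.out
  have hw0 := h.factor_ne_zero y hy
  rw [h.riemann_eq_curvature hy, curvature_projectiveChange hK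
      (differentiableAt_conformalGradient hw hw0) (h.extendedConnection_symm hy)
      (partialD_conformalGradient_comm hw hw0),
    projectiveSchouten_conformalGradient hw hw0 (h.hessian_eq hy a d),
    projectiveSchouten_conformalGradient hw hw0 (h.hessian_eq hy b d)]

theorem eventually_sum_partialD_mul_riemann (h : LocalAsymptoteAt R w Q N y₀) :
    ∀ᶠ y in 𝓝[interior R] y₀, ∀ d a b, ∑ c, partialD c w y
        * riemann (fun z => (w z)⁻¹ ^ 2 • cylinderMetric w Q z) y c d a b
      = w y * projectiveCotton (extendedConnection w Q N) (extendedSchouten w Q N) y d a b := by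
  have hS : ∀ᶠ y in 𝓝[interior R] y₀, ∀ i j,
      DifferentiableAt ℝ (fun z => extendedSchouten w Q N z i j) y :=
    eventually_all.2 fun i => eventually_all.2 fun j =>
      (h.extendsSmoothly_extendedSchouten i j).eventually_differentiableAt
  filter_upwards [self_mem_nhdsWithin, h.eventually_differentiableAt_extendedConnection, hS]
    with y hy hKy hSy d a b
  rw [h.riemann_eq_curvature hy]
  exact sum_mul_curvature_projectiveChange ((h.contDiffAt_factor hy).of_le ENat.LEInfty.out)
    (h.factor_ne_zero y hy) hKy (h.extendedConnection_symm hy) hSy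
    ((isOpen_interior.eventually_mem hy).mono fun z => h.hessian_eq) d a b

end LocalAsymptoteAt

end ExtendedCurvature

section Limits

variable {R : Set (EuclideanSpace ℝ (Fin 4))} {w : EuclideanSpace ℝ (Fin 4) → ℝ}
  {Q : EuclideanSpace ℝ (Fin 4) → Matrix (Fin 4) (Fin 4) ℝ}
  {N : EuclideanSpace ℝ (Fin 4) → EuclideanSpace ℝ (Fin 4)} {y y₀ : EuclideanSpace ℝ (Fin 4)}

namespace LocalAsymptote

theorem covectorSq_cylinderMetric (h : LocalAsymptote R w Q N) (hy : y ∈ interior R) :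
    covectorSq (cylinderMetric w Q y) (partialD · w y)
      = -(w y ^ 2 * (1 - w y ^ 2 * normalFactor w N y)) := by
  have hdot : covectorSq (cylinderMetric w Q y) (partialD · w y)
      = (partialD · w y) ⬝ᵥ (cylinderMetric w Q y)⁻¹.mulVec (partialD · w y) := by
    simp only [covectorSq, dotProduct, Matrix.mulVec, Finset.mul_sum]
    exact Finset.sum_congr rfl fun a _ => Finset.sum_congr rfl fun b _ => by ring
  rw [hdot, h.inv_mulVec_partialD hy, dotProduct_smul, h.dotProduct_normal hy, smul_eq_mul]
  ring

theorem unitNormal_mul_unitNormal (h : LocalAsymptote R w Q N) (hy : y ∈ interior R)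
    (hpos : 0 < 1 - w y ^ 2 * normalFactor w N y) (c d : Fin 4) :
    unitNormal (cylinderMetric w Q y) (partialD · w y) c
        * unitNormal (cylinderMetric w Q y) (partialD · w y) d
      = w y ^ 2 * (N y c * N y d) / (1 - w y ^ 2 * normalFactor w N y) := by
  have hw0 := h.factor_ne_zero y hy
  have hsq : 0 < w y ^ 2 * (1 - w y ^ 2 * normalFactor w N y) := by positivity
  have hnum : ∀ k, ∑ l, (cylinderMetric w Q y)⁻¹ k l * partialD l w y = w y ^ 2 * N y k :=
    congrFun (h.inv_mulVec_partialD hy)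
  rw [unitNormal, unitNormal, hnum, hnum, h.covectorSq_cylinderMetric hy, abs_neg,
    abs_of_pos hsq, div_mul_div_comm, Real.mul_self_sqrt hsq.le]
  field_simp

theorem weyl_cylinderMetric (h : LocalAsymptote R w Q N)
    (hflat : ∀ y ∈ interior R, ∀ a b,
      ricci (fun z => (w z)⁻¹ ^ 2 • cylinderMetric w Q z) y a b = 0)
    (hy : y ∈ interior R) (c d a b : Fin 4) :
    weyl (cylinderMetric w Q) y c d a b
      = ∑ e, cylinderMetric w Q y c e
        * riemann (fun z => (w z)⁻¹ ^ 2 • cylinderMetric w Q z) y e d a b :=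
  weyl_eq_of_conformal_ricci_eq_zero
    (fun i j => (h.contDiffAt_cylinderMetric hy i j).of_le ENat.LEInfty.out)
    ((h.contDiffAt_factor hy).of_le ENat.LEInfty.out) (h.factor_ne_zero y hy)
    (h.eventually_isSymm_cylinderMetric hy) (h.isUnit_det y hy) (hflat y hy) c d a b

end LocalAsymptote

theorem weylDual_eq_sqrt_mul (G : EuclideanSpace ℝ (Fin 4) → Matrix (Fin 4) (Fin 4) ℝ)
    (a c b d : Fin 4) :
    weylDual G y a c b d = Real.sqrt |(G y).det| * ((1 / 2) * ∑ p, ∑ r,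
      ((1 : Matrix (Fin 4) (Fin 4) ℝ).submatrix ![a, c, p, r] id).det
        * ∑ e, (G y)⁻¹ p e * ∑ f, (G y)⁻¹ r f * weyl G y e f b d) := by
  simp only [weylDual, volumeForm, Finset.mul_sum]
  exact Finset.sum_congr rfl fun _ _ => Finset.sum_congr rfl fun _ _ =>
    Finset.sum_congr rfl fun _ _ => Finset.sum_congr rfl fun _ _ => by ring

namespace LocalAsymptoteAt

theorem tendsto_one_sub_sq_mul_normalFactor (h : LocalAsymptoteAt R w Q N y₀) :
    Tendsto (fun y => 1 - w y ^ 2 * normalFactor w N y) (𝓝[interior R] y₀) (𝓝 1) := by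
  simpa only [sub_zero] using (h.tendsto_sq_mul h.extendsSmoothly_normalFactor).const_sub 1

theorem eventually_covectorSq_neg (h : LocalAsymptoteAt R w Q N y₀) :
    ∀ᶠ y in 𝓝[interior R] y₀, covectorSq (cylinderMetric w Q y) (partialD · w y) < 0 := by
  filter_upwards [self_mem_nhdsWithin,
    h.tendsto_one_sub_sq_mul_normalFactor.eventually_const_lt one_pos] with y hy hpos
  have hw0 := h.factor_ne_zero y hy
  rw [h.covectorSq_cylinderMetric hy, neg_lt_zero]
  positivity

theorem tendsto_sum_mul_unitNormal_mul_unitNormal (h : LocalAsymptoteAt R w Q N y₀)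
    {T : EuclideanSpace ℝ (Fin 4) → Fin 4 → Fin 4 → ℝ}
    (hT : ∀ c d, Tendsto (fun y => w y ^ 2 * T y c d) (𝓝[interior R] y₀) (𝓝 0)) :
    Tendsto (fun y => ∑ c, ∑ d, T y c d * unitNormal (cylinderMetric w Q y) (partialD · w y) c
      * unitNormal (cylinderMetric w Q y) (partialD · w y) d) (𝓝[interior R] y₀) (𝓝 0) := by
  have hterm : ∀ c d, Tendsto (fun y => w y ^ 2 * T y c d * (N y c * N y d)
      / (1 - w y ^ 2 * normalFactor w N y)) (𝓝[interior R] y₀) (𝓝 0) := fun c d => by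
    have hN := (h.extendsSmoothly_normal c).mul (h.extendsSmoothly_normal d)
    simpa only [zero_div] using!
      (hN.tendsto_mul_zero (hT c d)).div h.tendsto_one_sub_sq_mul_normalFactor one_ne_zero
  have hsum := tendsto_finsetSum Finset.univ fun c _ => tendsto_finsetSum Finset.univ fun d _ =>
    hterm c d
  simp only [Finset.sum_const_zero] at hsum
  refine hsum.congr' ?_
  filter_upwards [self_mem_nhdsWithin,
    h.tendsto_one_sub_sq_mul_normalFactor.eventually_const_lt one_pos] with y hy hpos
  refine Finset.sum_congr rfl fun c _ => Finset.sum_congr rfl fun d _ => ?_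
  rw [mul_assoc (T y c d), h.unitNormal_mul_unitNormal hy hpos]
  ring

theorem extendsSmoothly_factor_mul_weyl (h : LocalAsymptoteAt R w Q N y₀)
    (hflat : ∀ y ∈ interior R, ∀ a b,
      ricci (fun z => (w z)⁻¹ ^ 2 • cylinderMetric w Q z) y a b = 0) (c d a b : Fin 4) :
    ExtendsSmoothly R y₀ fun y => w y * weyl (cylinderMetric w Q) y c d a b := by
  have hw := h.extendsSmoothly_factor
  refine ((hw.mul (.sum fun e => (h.extendsSmoothly_metric c e).mul
    (h.extendsSmoothly_riemann e d a b))).sub ((h.extendsSmoothly_partialD hw c).mul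
      (h.extendsSmoothly_projectiveCotton d a b))).congr ?_
  filter_upwards [self_mem_nhdsWithin, h.eventually_sum_partialD_mul_riemann] with y hy hcotton
  have hw0 := h.factor_ne_zero y hy
  have hsplit : ∑ e, cylinderMetric w Q y c e
        * riemann (fun z => (w z)⁻¹ ^ 2 • cylinderMetric w Q z) y e d a b
      = ∑ e, Q y c e * riemann (fun z => (w z)⁻¹ ^ 2 • cylinderMetric w Q z) y e d a b
        - (w y)⁻¹ ^ 2 * partialD c w y * ∑ e, partialD e w y
          * riemann (fun z => (w z)⁻¹ ^ 2 • cylinderMetric w Q z) y e d a b := by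
    simp only [Finset.mul_sum, ← Finset.sum_sub_distrib]
    refine Finset.sum_congr rfl fun e _ => ?_
    simp only [cylinderMetric, Matrix.sub_apply, Matrix.smul_apply, Matrix.vecMulVec_apply,
      smul_eq_mul]
    ring
  rw [h.weyl_cylinderMetric hflat hy, hsplit, hcotton]
  field_simp

theorem tendsto_electricPart (h : LocalAsymptoteAt R w Q N y₀)
    (hflat : ∀ y ∈ interior R, ∀ a b,
      ricci (fun z => (w z)⁻¹ ^ 2 • cylinderMetric w Q z) y a b = 0) (a b : Fin 4) :
    Tendsto (fun y => electricPart (cylinderMetric w Q) w y a b) (𝓝[interior R] y₀) (𝓝 0) := by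
  refine h.tendsto_sum_mul_unitNormal_mul_unitNormal fun c d => ?_
  simpa only [sq, mul_assoc] using
    (h.extendsSmoothly_factor_mul_weyl hflat a c b d).tendsto_mul_zero h.tendsto_factor

theorem extendsSmoothly_sum_inv_mul_sum_inv_mul_weyl (h : LocalAsymptoteAt R w Q N y₀)
    (hflat : ∀ y ∈ interior R, ∀ a b,
      ricci (fun z => (w z)⁻¹ ^ 2 • cylinderMetric w Q z) y a b = 0) (p r b d : Fin 4) :
    ExtendsSmoothly R y₀ fun y => ∑ e, (cylinderMetric w Q y)⁻¹ p e
      * ∑ f, (cylinderMetric w Q y)⁻¹ r f * weyl (cylinderMetric w Q) y e f b d := by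
  refine (ExtendsSmoothly.sum fun f => (h.extendsSmoothly_inv_cylinderMetric r f).mul
    (h.extendsSmoothly_riemann p f b d)).congr ?_
  filter_upwards [self_mem_nhdsWithin] with y hy
  simp only [h.weyl_cylinderMetric hflat hy]
  calc _ = ∑ f, (cylinderMetric w Q y)⁻¹ r f * ∑ e, (cylinderMetric w Q y)⁻¹ p e
          * ∑ k, cylinderMetric w Q y e k
            * riemann (fun z => (w z)⁻¹ ^ 2 • cylinderMetric w Q z) y k f b d := by
        simp_rw [Finset.mul_sum (s := Finset.univ) (f := fun f => (cylinderMetric w Q y)⁻¹ r f * _),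
          Finset.mul_sum (s := Finset.univ) (f := fun e => (cylinderMetric w Q y)⁻¹ p e * _)]
        rw [Finset.sum_comm]
        exact Finset.sum_congr rfl fun f _ => Finset.sum_congr rfl fun e _ => mul_left_comm _ _ _
    _ = _ := Finset.sum_congr rfl fun f _ => by
        rw [sum_inv_mul_sum_mul (h.isUnit_det y hy)]

theorem tendsto_sq_mul_weylDual (h : LocalAsymptoteAt R w Q N y₀)
    (hflat : ∀ y ∈ interior R, ∀ a b,
      ricci (fun z => (w z)⁻¹ ^ 2 • cylinderMetric w Q z) y a b = 0) (a c b d : Fin 4) :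
    Tendsto (fun y => w y ^ 2 * weylDual (cylinderMetric w Q) y a c b d)
      (𝓝[interior R] y₀) (𝓝 0) := by
  have hdual := ExtendsSmoothly.mul (.const (1 / 2)) (.sum fun p => .sum fun r =>
    .mul (.const ((1 : Matrix (Fin 4) (Fin 4) ℝ).submatrix ![a, c, p, r] id).det)
      (h.extendsSmoothly_sum_inv_mul_sum_inv_mul_weyl hflat p r b d))
  obtain ⟨δ, hδ⟩ := h.extendsSmoothly_sq_mul_det_cylinderMetric.exists_tendsto
  have hroot : Tendsto (fun y => w y ^ 2 * Real.sqrt |(cylinderMetric w Q y).det|)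
      (𝓝[interior R] y₀) (𝓝 0) := by
    have hlim := h.tendsto_factor.abs.mul hδ.abs.sqrt
    rw [abs_zero, zero_mul] at hlim
    refine hlim.congr fun y => ?_
    rw [abs_mul, Real.sqrt_mul (abs_nonneg _), abs_of_nonneg (sq_nonneg (w y)), Real.sqrt_sq_eq_abs,
      ← sq_abs (w y)]
    ring
  simpa only [weylDual_eq_sqrt_mul, mul_assoc] using hdual.tendsto_mul_zero hroot

theorem tendsto_magneticPart (h : LocalAsymptoteAt R w Q N y₀)
    (hflat : ∀ y ∈ interior R, ∀ a b,
      ricci (fun z => (w z)⁻¹ ^ 2 • cylinderMetric w Q z) y a b = 0) (a b : Fin 4) :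
    Tendsto (fun y => magneticPart (cylinderMetric w Q) w y a b) (𝓝[interior R] y₀) (𝓝 0) :=
  h.tendsto_sum_mul_unitNormal_mul_unitNormal fun c d => h.tendsto_sq_mul_weylDual hflat a c b d

end LocalAsymptoteAt

end Limits

theorem fderivWithin_apply_eq_zero_of_eventually_eq {𝕜 E F : Type*} [NontriviallyNormedField 𝕜]
    [NormedAddCommGroup E] [NormedSpace 𝕜 E] [NormedAddCommGroup F] [NormedSpace 𝕜 F]
    {f : E → F} {s : Set E} {x v : E} (hf : DifferentiableWithinAt 𝕜 f s x)
    (hv : ∀ᶠ t : 𝕜 in 𝓝 0, x + t • v ∈ s ∧ f (x + t • v) = f x) :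
    fderivWithin 𝕜 f s x v = 0 := by
  have hline : HasDerivAt (fun t : 𝕜 => f (x + t • v)) (fderivWithin 𝕜 f s x v) 0 :=
    HasDerivWithinAt.hasDerivAt (hf.hasFDerivWithinAt.hasLineDerivWithinAt v)
      (hv.mono fun t ht => ht.1)
  exact (hline.congr_of_eventuallyEq (hv.mono fun t ht => ht.2.symm)).unique
    (hasDerivAt_const 0 (f x))

section Charts

variable {𝕜 E F H M : Type*} [NontriviallyNormedField 𝕜] [NormedAddCommGroup E] [NormedSpace 𝕜 E]
  [NormedAddCommGroup F] [NormedSpace 𝕜 F] [TopologicalSpace H] {I : ModelWithCorners 𝕜 E H}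
  [TopologicalSpace M] {e : OpenPartialHomeomorph M H} {n : WithTop ℕ∞} {p : M} {y : E}

theorem extend_symm_mem_source (hy : y ∈ (e.extend I).target) : (e.extend I).symm y ∈ e.source :=
  e.extend_source (I := I) ▸ (e.extend I).map_target hy

theorem extend_mem_target (hp : p ∈ e.source) : e.extend I p ∈ (e.extend I).target :=
  (e.extend I).map_source (e.extend_source (I := I) ▸ hp)

theorem uniqueDiffOn_extend_target : UniqueDiffOn 𝕜 (e.extend I).target :=
  e.extend_target (I := I) ▸ I.uniqueDiffOn_preimage e.open_target

theorem nhdsWithin_interior_extend_target_neBot (hy : y ∈ (e.extend I).target) :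
    NeBot (𝓝[interior (e.extend I).target] y) := by
  have hopen := e.open_target.preimage I.continuous_symm
  rw [e.extend_target] at hy ⊢
  rw [← mem_closure_iff_nhdsWithin_neBot, interior_inter, hopen.interior_eq]
  exact hopen.inter_closure ⟨hy.1, I.range_subset_closure_interior hy.2⟩

variable [ChartedSpace H M]

theorem mdifferentiableWithinAt_extend_symm (he : e ∈ IsManifold.maximalAtlas I n M) (hn : n ≠ 0)
    (hy : y ∈ (e.extend I).target) :
    MDifferentiableWithinAt 𝓘(𝕜, E) I (e.extend I).symm (range I) y := by
  have hsymm := contMDiffOn_extend_symm he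
  rw [← e.extend_target'] at hsymm
  refine ((hsymm y hy).mdifferentiableWithinAt hn).mono_of_mem_nhdsWithin ?_
  simpa only [(e.extend I).right_inv hy] using
    e.extend_target_mem_nhdsWithin (I := I) (extend_symm_mem_source hy)

theorem mfderivWithin_extend_symm_mfderiv_extend (he : e ∈ IsManifold.maximalAtlas I n M)
    (hn : n ≠ 0) (hy : y ∈ (e.extend I).target) (v : TangentSpace I ((e.extend I).symm y)) :
    mfderivWithin 𝓘(𝕜, E) I (e.extend I).symm (range I) y
      (mfderiv I 𝓘(𝕜, E) (e.extend I) ((e.extend I).symm y) v) = v := by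
  have hsource := extend_symm_mem_source hy
  have hunique : UniqueMDiffWithinAt I e.source ((e.extend I).symm y) :=
    e.open_source.uniqueMDiffWithinAt hsource
  have hdiff : MDifferentiableAt I 𝓘(𝕜, E) (e.extend I) ((e.extend I).symm y) :=
    (e.contMDiffAt_extend he hsource).mdifferentiableAt hn
  have hcomp := mfderivWithin_comp_of_eq (u := range I)
    (mdifferentiableWithinAt_extend_symm he hn hy) hdiff.mdifferentiableWithinAt
    (fun z _ => by simp) hunique ((e.extend I).right_inv hy)
  have hid : mfderivWithin I I ((e.extend I).symm ∘ e.extend I) e.source ((e.extend I).symm y)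
      = mfderivWithin I I id e.source ((e.extend I).symm y) :=
    mfderivWithin_congr (fun z hz => e.extend_left_inv hz) (e.extend_left_inv hsource)
  rw [hid, mfderivWithin_id hunique, mfderivWithin_eq_mfderiv hunique hdiff] at hcomp
  exact (DFunLike.congr_fun hcomp v).symm

theorem fderivWithin_comp_extend_symm (he : e ∈ IsManifold.maximalAtlas I n M) (hn : n ≠ 0)
    {f : M → F} (hy : y ∈ (e.extend I).target)
    (hf : MDifferentiableAt I 𝓘(𝕜, F) f ((e.extend I).symm y)) (v : E) :
    fderivWithin 𝕜 (f ∘ (e.extend I).symm) (e.extend I).target y v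
      = mfderiv I 𝓘(𝕜, F) f ((e.extend I).symm y)
        (mfderivWithin 𝓘(𝕜, E) I (e.extend I).symm (range I) y v) := by
  have hcomp := ((hf.hasMFDerivAt.comp_hasMFDerivWithinAt y
    (mdifferentiableWithinAt_extend_symm he hn hy).hasMFDerivWithinAt).mono
    e.extend_target_subset_range).mfderivWithin
    (uniqueDiffOn_extend_target y hy).uniqueMDiffWithinAt
  rw [mfderivWithin_eq_fderivWithin] at hcomp
  exact congrArg (fun L => L v) hcomp

theorem contDiffOn_comp_extend_symm (he : e ∈ IsManifold.maximalAtlas I n M) {f : M → F}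
    (hf : ContMDiff I 𝓘(𝕜, F) n f) :
    ContDiffOn 𝕜 n (f ∘ (e.extend I).symm) (e.extend I).target := by
  rw [e.extend_target']
  exact (hf.comp_contMDiffOn (contMDiffOn_extend_symm he)).contDiffOn

theorem isInteriorPoint_iff_extend_mem_interior (he : e ∈ IsManifold.maximalAtlas I n M)
    (hn : n ≠ 0) (hp : p ∈ e.source) :
    I.IsInteriorPoint p ↔ e.extend I p ∈ interior (e.extend I).target := by
  have hdiff : e.MDifferentiable I I :=
    ⟨(contMDiffOn_of_mem_maximalAtlas he).mdifferentiableOn hn,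
      (contMDiffOn_symm_of_mem_maximalAtlas he).mdifferentiableOn hn⟩
  suffices I.IsInteriorPoint p ↔ I.IsInteriorPoint (e p) from
    this.trans ⟨e.mem_interior_extend_target (e.map_source hp),
      fun h => e.interior_extend_target_subset_interior_range h⟩
  refine ⟨(hdiff.mdifferentiableAt hp).isInteriorPoint_of_surjective_mfderiv
    (hdiff.mfderiv_surjective hp), fun h => ?_⟩
  have hep := e.map_source hp
  simpa only [e.left_inv hp] using
    (hdiff.symm.mdifferentiableAt hep).isInteriorPoint_of_surjective_mfderiv
      (hdiff.symm.mfderiv_surjective hep) h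

theorem extend_symm_mem_source_inter_interior (he : e ∈ IsManifold.maximalAtlas I n M)
    (hn : n ≠ 0) (hy : y ∈ interior (e.extend I).target) :
    (e.extend I).symm y ∈ e.source ∩ I.interior M := by
  have hsource := extend_symm_mem_source (interior_subset hy)
  refine ⟨hsource, (isInteriorPoint_iff_extend_mem_interior he hn hsource).2 ?_⟩
  rwa [(e.extend I).right_inv (interior_subset hy)]

theorem tendsto_extend_nhdsWithin_interior (he : e ∈ IsManifold.maximalAtlas I n M)
    (hn : n ≠ 0) (hp : p ∈ e.source) :
    Tendsto (e.extend I) (𝓝[I.interior M] p) (𝓝[interior (e.extend I).target] (e.extend I p)) := by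
  refine tendsto_nhdsWithin_iff.2 ⟨(e.continuousAt_extend hp).continuousWithinAt.tendsto, ?_⟩
  filter_upwards [nhdsWithin_le_nhds (e.open_source.mem_nhds hp), self_mem_nhdsWithin]
    with x hx hxi
  exact (isInteriorPoint_iff_extend_mem_interior he hn hx).1 hxi

end Charts

namespace HasLorentzSignature

variable {n : ℕ} {A : Matrix (Fin (n + 1)) (Fin (n + 1)) ℝ}

theorem isSymm (h : HasLorentzSignature A) : A.IsSymm := by
  obtain ⟨P, hP, hA⟩ := h
  have hPt : IsUnit P.transpose.det := by rwa [Matrix.det_transpose]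
  have htranspose : P.transpose * A.transpose * P = P.transpose * A * P := by
    rw [hA, ← Matrix.diagonal_transpose, ← hA]
    simp only [Matrix.transpose_mul, Matrix.transpose_transpose, Matrix.mul_assoc]
  exact ((Matrix.isUnit_iff_isUnit_det _).2 hPt).mul_left_cancel
    (((Matrix.isUnit_iff_isUnit_det _).2 hP).mul_right_cancel htranspose)

theorem det_ne_zero (h : HasLorentzSignature A) : A.det ≠ 0 := by
  obtain ⟨P, _, hA⟩ := h
  intro hdet
  have hdiag := congrArg Matrix.det hA
  rw [Matrix.det_mul, Matrix.det_mul, hdet, mul_zero, zero_mul, Matrix.det_diagonal] at hdiag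
  refine Finset.prod_ne_zero_iff.2 (fun i _ => ?_) hdiag.symm
  cases i using Fin.cases <;> simp

end HasLorentzSignature

theorem eq_zero_of_det_submatrix_succ_ne_zero {K : Type*} [Field K] {n : ℕ}
    {A : Matrix (Fin (n + 1)) (Fin (n + 1)) K} {v : Fin (n + 1) → K}
    (hA : (A.submatrix Fin.succ Fin.succ).det ≠ 0) (hv₀ : v 0 = 0)
    (hv : ∀ u, u 0 = 0 → u ⬝ᵥ A.mulVec v = 0) : v = 0 := by
  have hker : (A.submatrix Fin.succ Fin.succ).mulVec (Fin.tail v) = 0 := by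
    ext i
    have hi := hv (Pi.single i.succ 1) (Pi.single_eq_of_ne (Fin.succ_ne_zero i).symm 1)
    rw [single_one_dotProduct, Matrix.mulVec, dotProduct, Fin.sum_univ_succ, hv₀, mul_zero,
      zero_add] at hi
    exact hi
  rw [← Fin.cons_self_tail v, hv₀, Matrix.eq_zero_of_mulVec_eq_zero hA hker]
  exact Matrix.cons_zero_zero

theorem isBoundaryPoint_iff_extend_zero_eq_zero {M : Type*} [TopologicalSpace M] {m : ℕ} [NeZero m]
    [ChartedSpace (EuclideanHalfSpace m) M] {e : OpenPartialHomeomorph M (EuclideanHalfSpace m)}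
    {n : WithTop ℕ∞} {p : M} (he : e ∈ IsManifold.maximalAtlas (𝓡∂ m) n M) (hn : n ≠ 0)
    (hp : p ∈ e.source) : (𝓡∂ m).IsBoundaryPoint p ↔ e.extend (𝓡∂ m) p 0 = 0 := by
  have hrange := e.extend_target_subset_range (extend_mem_target (I := 𝓡∂ m) hp)
  have hinterior : e.extend (𝓡∂ m) p ∈ interior (e.extend (𝓡∂ m)).target
      ↔ e.extend (𝓡∂ m) p ∈ interior (range (𝓡∂ m)) :=
    ⟨fun h => e.interior_extend_target_subset_interior_range h,
      e.mem_interior_extend_target (e.map_source hp)⟩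
  rw [range_modelWithCornersEuclideanHalfSpace] at hrange
  rw [(𝓡∂ m).isBoundaryPoint_iff_not_isInteriorPoint,
    isInteriorPoint_iff_extend_mem_interior he hn hp, hinterior,
    interior_range_modelWithCornersEuclideanHalfSpace]
  exact ⟨fun h => le_antisymm (not_lt.1 h) hrange, fun h => not_lt.2 h.le⟩

theorem sum_smul_map_single {ι F : Type*} [Fintype ι] [DecidableEq ι] [AddCommGroup F] [Module ℝ F]
    (L : EuclideanSpace ℝ ι →ₗ[ℝ] F) (v : EuclideanSpace ℝ ι) :
    ∑ i, v i • L (EuclideanSpace.single i 1) = L v := by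
  simp only [← map_smul, ← map_sum]
  congr 1
  ext j
  simp [Pi.single_apply]

section Components

variable {M : Type*} [TopologicalSpace M] [ChartedSpace (EuclideanHalfSpace 4) M]
  {e : OpenPartialHomeomorph M (EuclideanHalfSpace 4)} {n : WithTop ℕ∞}
  {y : EuclideanSpace ℝ (Fin 4)}

theorem fderivWithin_comp_extend_symm_single (he : e ∈ IsManifold.maximalAtlas (𝓡∂ 4) n M)
    (hn : n ≠ 0) {f : M → ℝ} (hy : y ∈ (e.extend (𝓡∂ 4)).target)
    (hf : MDifferentiableAt (𝓡∂ 4) 𝓘(ℝ, ℝ) f ((e.extend (𝓡∂ 4)).symm y)) (k : Fin 4) :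
    fderivWithin ℝ (f ∘ (e.extend (𝓡∂ 4)).symm) (e.extend (𝓡∂ 4)).target y
      (EuclideanSpace.single k 1)
      = differential f ((e.extend (𝓡∂ 4)).symm y) (coordVec e y k) :=
  fderivWithin_comp_extend_symm he hn hy hf _

theorem partialD_comp_extend_symm (he : e ∈ IsManifold.maximalAtlas (𝓡∂ 4) n M)
    (hn : n ≠ 0) {f : M → ℝ} (hy : y ∈ interior (e.extend (𝓡∂ 4)).target)
    (hf : MDifferentiableAt (𝓡∂ 4) 𝓘(ℝ, ℝ) f ((e.extend (𝓡∂ 4)).symm y)) (k : Fin 4) :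
    partialD k (f ∘ (e.extend (𝓡∂ 4)).symm) y
      = differential f ((e.extend (𝓡∂ 4)).symm y) (coordVec e y k) := by
  rw [partialD, ← fderivWithin_of_mem_nhds (mem_interior_iff_mem_nhds.1 hy),
    fderivWithin_comp_extend_symm_single he hn (interior_subset hy) hf]

theorem sum_smul_coordVec (he : e ∈ IsManifold.maximalAtlas (𝓡∂ 4) n M) (hn : n ≠ 0)
    (hy : y ∈ (e.extend (𝓡∂ 4)).target) (N : ∀ x : M, TangentSpace (𝓡∂ 4) x) :
    ∑ i, vectorComponents e N y i • coordVec e y i = N ((e.extend (𝓡∂ 4)).symm y) :=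
  (sum_smul_map_single
    (mfderivWithin 𝓘(ℝ, EuclideanSpace ℝ (Fin 4)) (𝓡∂ 4) (e.extend (𝓡∂ 4)).symm
      (range (𝓡∂ 4)) y).toLinearMap (vectorComponents e N y)).trans
    (mfderivWithin_extend_symm_mfderiv_extend he hn hy _)

theorem vecMul_components (he : e ∈ IsManifold.maximalAtlas (𝓡∂ 4) n M) (hn : n ≠ 0)
    (hy : y ∈ (e.extend (𝓡∂ 4)).target) (N : ∀ x : M, TangentSpace (𝓡∂ 4) x)
    (g : ∀ x : M, LinearMap.BilinForm ℝ (TangentSpace (𝓡∂ 4) x)) (i : Fin 4) :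
    Matrix.vecMul (vectorComponents e N y) (components e g y) i
      = g _ (N ((e.extend (𝓡∂ 4)).symm y)) (coordVec e y i) := by
  rw [← sum_smul_coordVec he hn hy N, map_sum, LinearMap.sum_apply]
  simp only [map_smul, LinearMap.smul_apply, smul_eq_mul]
  rfl

theorem components_conformalMetric (Ω : M → ℝ)
    (g : ∀ x : M, LinearMap.BilinForm ℝ (TangentSpace (𝓡∂ 4) x)) :
    components e (conformalMetric Ω g) y
      = Ω ((e.extend (𝓡∂ 4)).symm y) ^ 2 • components e g y :=
  rfl

theorem slicePoint_bdryCoord {p : M} (he : e ∈ IsManifold.maximalAtlas (𝓡∂ 4) n M) (hn : n ≠ 0)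
    (hp : p ∈ (𝓡∂ 4).boundary M) (hpe : p ∈ e.source) :
    slicePoint (bdryCoord e p) = e.extend (𝓡∂ 4) p := by
  ext i
  cases i using Fin.cases with
  | zero => simpa [slicePoint] using ((isBoundaryPoint_iff_extend_zero_eq_zero he hn hpe).1 hp).symm
  | succ j => simp [slicePoint, bdryCoord]

end Components

section Asymptote

variable {M : Type*} [TopologicalSpace M] [ChartedSpace (EuclideanHalfSpace 4) M]
  {e : OpenPartialHomeomorph M (EuclideanHalfSpace 4)} {Ω : M → ℝ}
  {g q : ∀ x : M, LinearMap.BilinForm ℝ (TangentSpace (𝓡∂ 4) x)}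
  {N : ∀ x : M, TangentSpace (𝓡∂ 4) x} {y : EuclideanSpace ℝ (Fin 4)} {p : M}

theorem IsVacuumSpacetime.hasLorentzSignature_components (h : IsVacuumSpacetime M g)
    (he : e ∈ IsManifold.maximalAtlas (𝓡∂ 4) ∞ M) (hy : y ∈ interior (e.extend (𝓡∂ 4)).target) :
    HasLorentzSignature (components e g y) := by
  have hsignature := h.lorentzian e he _ (extend_symm_mem_source_inter_interior he (by simp) hy)
  rwa [(e.extend (𝓡∂ 4)).right_inv (interior_subset hy)] at hsignature

theorem IsVacuumSpacetime.ricci_components (h : IsVacuumSpacetime M g)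
    (he : e ∈ IsManifold.maximalAtlas (𝓡∂ 4) ∞ M) (hy : y ∈ interior (e.extend (𝓡∂ 4)).target)
    (a b : Fin 4) : ricci (components e g) y a b = 0 := by
  have hricci := h.ricci_flat e he _ (extend_symm_mem_source_inter_interior he (by simp) hy) a b
  rwa [(e.extend (𝓡∂ 4)).right_inv (interior_subset hy)] at hricci

namespace HasAsymptote

theorem mdifferentiableAt_factor (h : HasAsymptote M g Ω q N) (x : M) :
    MDifferentiableAt (𝓡∂ 4) 𝓘(ℝ, ℝ) Ω x :=
  h.smooth_factor.contMDiffAt.mdifferentiableAt (by simp)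

theorem factor_comp_extend_symm_ne_zero (h : HasAsymptote M g Ω q N)
    (he : e ∈ IsManifold.maximalAtlas (𝓡∂ 4) ∞ M) (hy : y ∈ interior (e.extend (𝓡∂ 4)).target) :
    Ω ((e.extend (𝓡∂ 4)).symm y) ≠ 0 :=
  h.factor_ne_zero _ (extend_symm_mem_source_inter_interior he (by simp) hy).2

theorem components_conformalMetric_eq_cylinderMetric (h : HasAsymptote M g Ω q N)
    (he : e ∈ IsManifold.maximalAtlas (𝓡∂ 4) ∞ M) (hy : y ∈ interior (e.extend (𝓡∂ 4)).target) :
    components e (conformalMetric Ω g) y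
      = cylinderMetric (Ω ∘ (e.extend (𝓡∂ 4)).symm) (components e q) y := by
  have hx := extend_symm_mem_source_inter_interior he (by simp) hy
  have hΩ := h.factor_comp_extend_symm_ne_zero he hy
  ext i j
  rw [cylinderMetric, Matrix.sub_apply, Matrix.smul_apply, Matrix.vecMulVec_apply,
    partialD_comp_extend_symm he (by simp) hy (h.mdifferentiableAt_factor _),
    partialD_comp_extend_symm he (by simp) hy (h.mdifferentiableAt_factor _),
    components, components, Matrix.of_apply, Matrix.of_apply, h.q_eq _ hx.2]
  simp only [conformalMetric, LinearMap.smul_apply, smul_eq_mul, Function.comp_apply]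
  field_simp
  ring

theorem eventually_components_conformalMetric_eq (h : HasAsymptote M g Ω q N)
    (he : e ∈ IsManifold.maximalAtlas (𝓡∂ 4) ∞ M) (hy : y ∈ interior (e.extend (𝓡∂ 4)).target) :
    components e (conformalMetric Ω g)
      =ᶠ[𝓝 y] cylinderMetric (Ω ∘ (e.extend (𝓡∂ 4)).symm) (components e q) :=
  (isOpen_interior.eventually_mem hy).mono
    fun _ hz => h.components_conformalMetric_eq_cylinderMetric he hz

theorem components_eq_smul_cylinderMetric (h : HasAsymptote M g Ω q N)
    (he : e ∈ IsManifold.maximalAtlas (𝓡∂ 4) ∞ M) (hy : y ∈ interior (e.extend (𝓡∂ 4)).target) :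
    components e g y = (Ω ((e.extend (𝓡∂ 4)).symm y))⁻¹ ^ 2
      • cylinderMetric (Ω ∘ (e.extend (𝓡∂ 4)).symm) (components e q) y := by
  have hΩ := h.factor_comp_extend_symm_ne_zero he hy
  rw [← h.components_conformalMetric_eq_cylinderMetric he hy, components_conformalMetric,
    smul_smul, ← mul_pow, inv_mul_cancel₀ hΩ, one_pow, one_smul]

theorem ricci_smul_cylinderMetric (h : HasAsymptote M g Ω q N)
    (he : e ∈ IsManifold.maximalAtlas (𝓡∂ 4) ∞ M) (hy : y ∈ interior (e.extend (𝓡∂ 4)).target)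
    (a b : Fin 4) :
    ricci (fun z => (Ω ((e.extend (𝓡∂ 4)).symm z))⁻¹ ^ 2
      • cylinderMetric (Ω ∘ (e.extend (𝓡∂ 4)).symm) (components e q) z) y a b = 0 := by
  have heq : components e g =ᶠ[𝓝 y] fun z => (Ω ((e.extend (𝓡∂ 4)).symm z))⁻¹ ^ 2
      • cylinderMetric (Ω ∘ (e.extend (𝓡∂ 4)).symm) (components e q) z :=
    (isOpen_interior.eventually_mem hy).mono
      fun _ hz => h.components_eq_smul_cylinderMetric he hz
  rw [← ricci_congr heq, h.vacuum.ricci_components he hy]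

theorem isSymm_cylinderMetric (h : HasAsymptote M g Ω q N)
    (he : e ∈ IsManifold.maximalAtlas (𝓡∂ 4) ∞ M) (hy : y ∈ interior (e.extend (𝓡∂ 4)).target) :
    (cylinderMetric (Ω ∘ (e.extend (𝓡∂ 4)).symm) (components e q) y).IsSymm := by
  rw [← h.components_conformalMetric_eq_cylinderMetric he hy, components_conformalMetric]
  exact (h.vacuum.hasLorentzSignature_components he hy).isSymm.smul _

theorem isUnit_det_cylinderMetric (h : HasAsymptote M g Ω q N)
    (he : e ∈ IsManifold.maximalAtlas (𝓡∂ 4) ∞ M) (hy : y ∈ interior (e.extend (𝓡∂ 4)).target) :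
    IsUnit (cylinderMetric (Ω ∘ (e.extend (𝓡∂ 4)).symm) (components e q) y).det := by
  rw [← h.components_conformalMetric_eq_cylinderMetric he hy, components_conformalMetric,
    Matrix.det_smul]
  exact (mul_ne_zero (pow_ne_zero _ (pow_ne_zero _ (h.factor_comp_extend_symm_ne_zero he hy)))
    (h.vacuum.hasLorentzSignature_components he hy).det_ne_zero).isUnit

theorem cylinderMetric_mulVec_vectorComponents (h : HasAsymptote M g Ω q N)
    (he : e ∈ IsManifold.maximalAtlas (𝓡∂ 4) ∞ M) (hy : y ∈ interior (e.extend (𝓡∂ 4)).target) :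
    (cylinderMetric (Ω ∘ (e.extend (𝓡∂ 4)).symm) (components e q) y).mulVec
        (vectorComponents e N y)
      = (Ω ((e.extend (𝓡∂ 4)).symm y))⁻¹ ^ 2
        • (partialD · (Ω ∘ (e.extend (𝓡∂ 4)).symm) y) := by
  have hx := extend_symm_mem_source_inter_interior he (by simp) hy
  have hΩ := h.factor_comp_extend_symm_ne_zero he hy
  ext i
  rw [← (h.isSymm_cylinderMetric he hy).eq, Matrix.mulVec_transpose,
    ← h.components_conformalMetric_eq_cylinderMetric he hy,
    vecMul_components he (by simp) (interior_subset hy), conformalMetric, LinearMap.smul_apply,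
    LinearMap.smul_apply, h.N_eq _ hx.2, Pi.smul_apply,
    partialD_comp_extend_symm he (by simp) hy (h.mdifferentiableAt_factor _), smul_eq_mul,
    smul_eq_mul]
  field_simp

theorem localAsymptote (h : HasAsymptote M g Ω q N)
    (he : e ∈ IsManifold.maximalAtlas (𝓡∂ 4) ∞ M) :
    LocalAsymptote (e.extend (𝓡∂ 4)).target (Ω ∘ (e.extend (𝓡∂ 4)).symm) (components e q)
      (vectorComponents e N) where
  uniqueDiffOn := uniqueDiffOn_extend_target
  contDiffOn_factor := contDiffOn_comp_extend_symm he h.smooth_factor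
  contDiffOn_metric := h.q_smooth e he
  contDiffOn_normal := h.N_smooth e he
  factor_ne_zero _ hy := h.factor_comp_extend_symm_ne_zero he hy
  isSymm y hy := by
    set α := (partialD · (Ω ∘ (e.extend (𝓡∂ 4)).symm) y)
    have hsymm := (h.isSymm_cylinderMetric he hy).add
      (Matrix.IsSymm.smul (Matrix.transpose_vecMulVec α α) ((Ω ((e.extend (𝓡∂ 4)).symm y))⁻¹ ^ 2))
    rwa [cylinderMetric, Function.comp_apply, sub_add_cancel] at hsymm
  isUnit_det _ hy := h.isUnit_det_cylinderMetric he hy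
  mulVec_normal _ hy := h.cylinderMetric_mulVec_vectorComponents he hy

theorem boundaryConormal_succ (h : HasAsymptote M g Ω q N)
    (he : e ∈ IsManifold.maximalAtlas (𝓡∂ 4) ∞ M) (hp : p ∈ (𝓡∂ 4).boundary M)
    (hpe : p ∈ e.source) (i : Fin 3) :
    boundaryConormal (e.extend (𝓡∂ 4)).target (Ω ∘ (e.extend (𝓡∂ 4)).symm)
      (e.extend (𝓡∂ 4) p) i.succ = 0 := by
  have hp0 := (isBoundaryPoint_iff_extend_zero_eq_zero he (by simp) hpe).1 hp
  have hfactor {z : EuclideanSpace ℝ (Fin 4)} (hz : z ∈ (e.extend (𝓡∂ 4)).target)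
      (hz0 : z 0 = 0) : Ω ((e.extend (𝓡∂ 4)).symm z) = 0 := by
    refine h.factor_eq_zero _ ((isBoundaryPoint_iff_extend_zero_eq_zero he (by simp)
      (extend_symm_mem_source hz)).2 ?_)
    rwa [(e.extend (𝓡∂ 4)).right_inv hz]
  have hline0 (t : ℝ) :
      (e.extend (𝓡∂ 4) p + t • EuclideanSpace.single i.succ (1 : ℝ)) 0 = 0 := by
    rw [PiLp.add_apply, hp0]
    simp
  have hline : Tendsto (fun t : ℝ => e.extend (𝓡∂ 4) p + t • EuclideanSpace.single i.succ (1 : ℝ))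
      (𝓝 0) (𝓝[range (𝓡∂ 4)] (e.extend (𝓡∂ 4) p)) := by
    refine tendsto_nhdsWithin_iff.2 ⟨Continuous.tendsto' (by fun_prop) _ _ (by simp),
      Eventually.of_forall fun t => ?_⟩
    rw [range_modelWithCornersEuclideanHalfSpace]
    exact (hline0 t).ge
  refine fderivWithin_apply_eq_zero_of_eventually_eq
    ((contDiffOn_comp_extend_symm he h.smooth_factor).differentiableOn (by simp) _
      (extend_mem_target hpe)) ?_
  filter_upwards [hline (e.extend_target_mem_nhdsWithin hpe)] with t ht
  exact ⟨ht, (hfactor ht (hline0 t)).trans (hfactor (extend_mem_target hpe) hp0).symm⟩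

theorem boundaryConormal_ne_zero (h : HasAsymptote M g Ω q N)
    (he : e ∈ IsManifold.maximalAtlas (𝓡∂ 4) ∞ M) (hp : p ∈ (𝓡∂ 4).boundary M)
    (hpe : p ∈ e.source) :
    boundaryConormal (e.extend (𝓡∂ 4)).target (Ω ∘ (e.extend (𝓡∂ 4)).symm)
      (e.extend (𝓡∂ 4) p) ≠ 0 := by
  intro hzero
  have hmem := extend_mem_target (I := 𝓡∂ 4) hpe
  set φ := e.extend (𝓡∂ 4)
  have hφp : φ.symm (φ p) = p := e.extend_left_inv hpe
  obtain ⟨v, hv⟩ := h.differential_ne_zero (φ.symm (φ p)) (by rwa [hφp])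
  let u : EuclideanSpace ℝ (Fin 4) :=
    mfderiv (𝓡∂ 4) 𝓘(ℝ, EuclideanSpace ℝ (Fin 4)) φ (φ.symm (φ p)) v
  have hu : fderivWithin ℝ (Ω ∘ φ.symm) φ.target (φ p) u = differential Ω (φ.symm (φ p)) v :=
    (fderivWithin_comp_extend_symm he (by simp) hmem (h.mdifferentiableAt_factor _) u).trans
      (congrArg (differential Ω _) (mfderivWithin_extend_symm_mfderiv_extend he (by simp) hmem v))
  refine hv (hu.symm.trans ((sum_smul_map_single
    (fderivWithin ℝ (Ω ∘ φ.symm) φ.target (φ p)).toLinearMap u).symm.trans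
    (Finset.sum_eq_zero fun i _ => ?_)))
  exact (congrArg _ (congrFun hzero i)).trans (smul_zero _)

theorem boundaryConormal_dotProduct_eq_zero_iff (h : HasAsymptote M g Ω q N)
    (he : e ∈ IsManifold.maximalAtlas (𝓡∂ 4) ∞ M) (hp : p ∈ (𝓡∂ 4).boundary M)
    (hpe : p ∈ e.source) (u : Fin 4 → ℝ) :
    boundaryConormal (e.extend (𝓡∂ 4)).target (Ω ∘ (e.extend (𝓡∂ 4)).symm)
      (e.extend (𝓡∂ 4) p) ⬝ᵥ u = 0 ↔ u 0 = 0 := by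
  have hconormal_zero : boundaryConormal (e.extend (𝓡∂ 4)).target
      (Ω ∘ (e.extend (𝓡∂ 4)).symm) (e.extend (𝓡∂ 4) p) 0 ≠ 0 := by
    refine fun h0 => h.boundaryConormal_ne_zero he hp hpe (funext fun i => ?_)
    cases i using Fin.cases with
    | zero => exact h0
    | succ i => exact h.boundaryConormal_succ he hp hpe i
  rw [dotProduct, Fin.sum_univ_succ]
  simp only [h.boundaryConormal_succ he hp hpe, zero_mul, Finset.sum_const_zero, add_zero,
    mul_eq_zero, hconormal_zero, false_or]

theorem localAsymptoteAt (h : HasAsymptote M g Ω q N)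
    (he : e ∈ IsManifold.maximalAtlas (𝓡∂ 4) ∞ M) (hp : p ∈ (𝓡∂ 4).boundary M)
    (hpe : p ∈ e.source) :
    LocalAsymptoteAt (e.extend (𝓡∂ 4)).target (Ω ∘ (e.extend (𝓡∂ 4)).symm) (components e q)
      (vectorComponents e N) (e.extend (𝓡∂ 4) p) where
  toLocalAsymptote := h.localAsymptote he
  mem := extend_mem_target hpe
  neBot := nhdsWithin_interior_extend_target_neBot (extend_mem_target hpe)
  factor_eq_zero := (congrArg Ω (e.extend_left_inv hpe)).trans (h.factor_eq_zero p hp)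
  boundaryConormal_ne_zero := h.boundaryConormal_ne_zero he hp hpe
  nondegenerate v hv hQ := by
    have hdet := (h.q_signature e he p ⟨hpe, hp⟩).det_ne_zero
    rw [bdryMetric, slicePoint_bdryCoord he (by simp) hp hpe] at hdet
    simp only [h.boundaryConormal_dotProduct_eq_zero_iff he hp hpe] at hv hQ
    exact eq_zero_of_det_submatrix_succ_ne_zero hdet hv hQ

end HasAsymptote

end Asymptote

end SpatialInfinity

end

theorem mainTheorem4_general {M : Type*} [TopologicalSpace M]
    [ChartedSpace (EuclideanHalfSpace 4) M]
    (g : ∀ x : M, LinearMap.BilinForm ℝ (TangentSpace (𝓡∂ 4) x)) (Ω : M → ℝ)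
    (q : ∀ x : M, LinearMap.BilinForm ℝ (TangentSpace (𝓡∂ 4) x))
    (N : ∀ x : M, TangentSpace (𝓡∂ 4) x)
    (h : SpatialInfinity.HasAsymptote M g Ω q N)
    (p : M) (hp : p ∈ (𝓡∂ 4).boundary M)
    (e : OpenPartialHomeomorph M (EuclideanHalfSpace 4))
    (he : e ∈ IsManifold.maximalAtlas (𝓡∂ 4) ∞ M) (hpe : p ∈ e.source) :
    (∀ᶠ x in 𝓝[(𝓡∂ 4).interior M] p,
      SpatialInfinity.covectorSq
        (SpatialInfinity.components e (SpatialInfinity.conformalMetric Ω g) (e.extend (𝓡∂ 4) x))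
        (fun k => SpatialInfinity.partialD k (fun z => Ω ((e.extend (𝓡∂ 4)).symm z))
          (e.extend (𝓡∂ 4) x)) < 0) ∧
    (∀ a b : Fin 4, Filter.Tendsto
      (fun x => SpatialInfinity.electricPart
        (SpatialInfinity.components e (SpatialInfinity.conformalMetric Ω g))
        (fun z => Ω ((e.extend (𝓡∂ 4)).symm z)) (e.extend (𝓡∂ 4) x) a b)
      (𝓝[(𝓡∂ 4).interior M] p) (𝓝 0)) ∧
    (∀ a b : Fin 4, Filter.Tendsto
      (fun x => SpatialInfinity.magneticPart
        (SpatialInfinity.components e (SpatialInfinity.conformalMetric Ω g))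
        (fun z => Ω ((e.extend (𝓡∂ 4)).symm z)) (e.extend (𝓡∂ 4) x) a b)
      (𝓝[(𝓡∂ 4).interior M] p) (𝓝 0)) := by
  have hlimit := SpatialInfinity.tendsto_extend_nhdsWithin_interior he (by simp) hpe
  have hasymptote := h.localAsymptoteAt he hp hpe
  have hmetric := hlimit.eventually
    (eventually_mem_nhdsWithin.mono fun _ hy => h.eventually_components_conformalMetric_eq he hy)
  refine ⟨?_, fun a b => ?_, fun a b => ?_⟩
  · filter_upwards [hmetric, hlimit.eventually hasymptote.eventually_covectorSq_neg] with x hx hneg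
    rwa [hx.eq_of_nhds]
  · refine ((hasymptote.tendsto_electricPart
      (fun _ hy => h.ricci_smul_cylinderMetric he hy) a b).comp hlimit).congr' ?_
    exact hmetric.mono fun x hx => (SpatialInfinity.electricPart_congr hx a b).symm
  · refine ((hasymptote.tendsto_magneticPart
      (fun _ hy => h.ricci_smul_cylinderMetric he hy) a b).comp hlimit).congr' ?_
    exact hmetric.mono fun x hx => (SpatialInfinity.magneticPart_congr hx a b).symm

theorem mainTheorem4 {M : Type*} [TopologicalSpace M] [ChartedSpace (EuclideanHalfSpace 4) M]
    [IsManifold (𝓡∂ 4) ∞ M]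
    (g : ∀ x : M, LinearMap.BilinForm ℝ (TangentSpace (𝓡∂ 4) x)) (Ω : M → ℝ)
    (q : ∀ x : M, LinearMap.BilinForm ℝ (TangentSpace (𝓡∂ 4) x))
    (N : ∀ x : M, TangentSpace (𝓡∂ 4) x)
    (h : SpatialInfinity.IsAMSI M g Ω q N)
    (p : M) (hp : p ∈ (𝓡∂ 4).boundary M)
    (e : OpenPartialHomeomorph M (EuclideanHalfSpace 4))
    (he : e ∈ IsManifold.maximalAtlas (𝓡∂ 4) ∞ M) (hpe : p ∈ e.source) :
    -- near `p` the level sets of `Ω` have a spacelike normal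
    (∀ᶠ x in 𝓝[(𝓡∂ 4).interior M] p,
      SpatialInfinity.covectorSq
        (SpatialInfinity.components e (SpatialInfinity.conformalMetric Ω g) (e.extend (𝓡∂ 4) x))
        (fun k => SpatialInfinity.partialD k (fun z => Ω ((e.extend (𝓡∂ 4)).symm z))
          (e.extend (𝓡∂ 4) x)) < 0) ∧
    (∀ a b : Fin 4, Filter.Tendsto
      (fun x => SpatialInfinity.electricPart
        (SpatialInfinity.components e (SpatialInfinity.conformalMetric Ω g))
        (fun z => Ω ((e.extend (𝓡∂ 4)).symm z)) (e.extend (𝓡∂ 4) x) a b)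
      (𝓝[(𝓡∂ 4).interior M] p) (𝓝 0)) ∧
    (∀ a b : Fin 4, Filter.Tendsto
      (fun x => SpatialInfinity.magneticPart
        (SpatialInfinity.components e (SpatialInfinity.conformalMetric Ω g))
        (fun z => Ω ((e.extend (𝓡∂ 4)).symm z)) (e.extend (𝓡∂ 4) x) a b)
      (𝓝[(𝓡∂ 4).interior M] p) (𝓝 0)) :=
  mainTheorem4_general g Ω q N h.toHasAsymptote p hp e he hpe
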